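/- Let $G$ be a real Lie group with Lie algebra $\mathfrak g$, and let $P=G\times\mathfrak g$ be the trivial principal $G$-bundle over the vector space $\mathfrak g$, with $G$ acting by left multiplication on the first factor. For $\rho\in\mathfrak g$ let $\rho^*$ be the fundamental vector field on $P$. Let $\theta$ be a smooth connection $1$-form on $P$ (so $\theta$ is $\mathfrak g$-valued, $\theta(\rho^*)=\rho$, and $\theta$ is $\mathrm{Ad}$-equivariant) and let $L$ be a smooth $\mathrm{Ad}$-equivariant $\mathfrak g$-valued $1$-form on $P$ whose kernel at each point is exactly the vertical space. Let $I$ be the almost complex structure on $P$ determined by $\theta(IX)=-L(X)$, $L(IX)=\theta(X)$ (equivalently, $I\rho^*$ is the horizontal vector $Y$ with $L(Y)=\rho$, and $I^2=-1$), and assume that $I$ is integrable. Let $\mu:P\to\mathfrak g^*$ be a smooth map, equivariant for the coadjoint action. For $\xi\in\mathfrak g^*$ define $\operatorname{ad}\xi:\mathfrak g\to\mathfrak g^*$ by $\langle\operatorname{ad}\xi(x),y\rangle=\langle\xi,[x,y]\rangle$, and let $D\mu=d\mu+(\operatorname{ad}\mu)\circ\theta$ be the covariant derivative of $\mu$. Assume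 that $\mu$ is regular, i.e. that only vertical vectors are in the kernel of $D\mu$. Then there is a unique function $\Phi$ on $P$ with values in the invertible linear maps $\mathfrak g^*\to\mathfrak g$ such that $L=\Phi(D\mu)$. We regard $\Phi$ at each point as the bilinear form $(x,y)\mapsto\langle x,\Phi(y)\rangle$ on $\mathfrak g^*$. There is a $G$-invariant Kähler metric $g$ on $(P,I)$, with Kähler form $\omega=g(I\cdot,\cdot)$, for which $\mu$ is a moment map (i.e. $d\langle\mu,\rho\rangle=\omega(\rho^*,\cdot)$ for all $\rho\in\mathfrak g$) if and only if, at every point of $P$, $\Phi$ is symmetric and both $\Phi$ and $\Phi+\Phi\circ(\operatorname{ad}\mu\circ\Phi)^2$ are positive definite. In this case every such metric is given, for tangent vectors $X,Y$ at a point of $P$, by $$g(X,Y)=\langle\Phi(D\mu(X)),D\mu(Y)\rangle+\langle\Phi^{-1}(\theta(X)),\theta(Y)\rangle+\big\langle\mu,\,[\Phi(D\mu(X)),\theta(Y)]-[\theta(X),\Phi(D\mu(Y))]\big\rangle,$$ and its Kähler form is $\omega=-d\langle\mu,\theta\rangle$, where $d\alpha(X,Y)=X(\alpha(Y))-Y(\alpha(X))-\alpha([X,Y])$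 for $1$-forms $\alpha$. -/

import Mathlib

open scoped Manifold ContDiff Bundle

noncomputable section

namespace KahlerGC

/-! ### The exterior derivative on a manifold -/

section ExtDeriv

variable {V : Type*} [NormedAddCommGroup V] [NormedSpace ℝ V]
  {H : Type*} [TopologicalSpace H] (J : ModelWithCorners ℝ V H)
  {M : Type*} [TopologicalSpace M] [ChartedSpace H M]

/-- A (not necessarily smooth) real differential `n`-form on a manifold. -/
abbrev DiffForm (n : ℕ) : Type _ := (p : M) → TangentSpace J p [⋀^Fin n]→L[ℝ] ℝ

variable {J}

/-- The expression of a differential form in the preferred chart at `p₀`: the pull-back of the form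
under the inverse of the chart. -/
def DiffForm.inChart {n : ℕ} (α : DiffForm J (M := M) n) (p₀ : M) (y : V) : V [⋀^Fin n]→L[ℝ] ℝ :=
  (α ((extChartAt J p₀).symm y)).compContinuousLinearMap
    (mfderiv 𝓘(ℝ, V) J (extChartAt J p₀).symm y :
      V →L[ℝ] TangentSpace J ((extChartAt J p₀).symm y))

/-- The exterior derivative on a manifold without boundary, computed at `p` in the preferred chart
at `p`; that chart identifies `T_p M` with the model space. The normalization is
`dα(X, Y) = X (α Y) - Y (α X) - α [X, Y]` for `1`-forms. -/
def DiffForm.d {n : ℕ} (α : DiffForm J (M := M) n) : DiffForm J (M := M) (n + 1) :=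
  fun p => (extDeriv (α.inChart p) (extChartAt J p p) : V [⋀^Fin (n + 1)]→L[ℝ] ℝ)

variable (J) in
/-- Integrability of an almost complex structure `I`: its Nijenhuis tensor vanishes. -/
def IsIntegrable [IsManifold J ∞ M] (I : (p : M) → TangentSpace J p →L[ℝ] TangentSpace J p) :
    Prop :=
  ∀ X Y : (p : M) → TangentSpace J p,
    ContMDiff J J.tangent ∞ (fun p => (⟨p, X p⟩ : TangentBundle J M)) →
    ContMDiff J J.tangent ∞ (fun p => (⟨p, Y p⟩ : TangentBundle J M)) →
    ∀ p : M,
      VectorField.mlieBracket J (fun q => I q (X q)) (fun q => I q (Y q)) p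
        - I p (VectorField.mlieBracket J (fun q => I q (X q)) Y p)
        - I p (VectorField.mlieBracket J X (fun q => I q (Y q)) p)
        - VectorField.mlieBracket J X Y p = 0

end ExtDeriv

/-! ### The Lie algebra and the trivial bundle `P = G × 𝔤`

`G` is a Lie group modelled on the finite-dimensional space `E`. In Mathlib its Lie algebra
`GroupLieAlgebra 𝓘(ℝ, E) G`, the tangent space at `1`, is by definition the vector space `E`, with
the bracket of left-invariant vector fields. So `𝔤` is written `E`, its dual `E →L[ℝ] ℝ`, and
`P` is the manifold `G × E`. -/

variable {E : Type*} [NormedAddCommGroup E] [NormedSpace ℝ E] [FiniteDimensional ℝ E]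
  {G : Type*} [TopologicalSpace G] [ChartedSpace E G] [Group G]

/-- The Lie bracket of `𝔤 = T₁G`. -/
def lieBr (G : Type*) [TopologicalSpace G] [ChartedSpace E G] [Group G] (x y : E) : E :=
  Bracket.bracket (L := GroupLieAlgebra 𝓘(ℝ, E) G) (M := GroupLieAlgebra 𝓘(ℝ, E) G) x y

/-- The adjoint action of `g ∈ G` on `𝔤`: the differential at `1` of `h ↦ g h g⁻¹`. -/
def Ad (g : G) : E →L[ℝ] E :=
  (mfderiv 𝓘(ℝ, E) 𝓘(ℝ, E) (fun h : G => g * h * g⁻¹) 1 : _)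

/-- The coadjoint action of `g ∈ G` on `𝔤*`: `⟨Ad*_g ξ, x⟩ = ⟨ξ, Ad_{g⁻¹} x⟩`. -/
def coAd (g : G) (ξ : E →L[ℝ] ℝ) : E →L[ℝ] ℝ := ξ.comp (Ad g⁻¹)

theorem lieGroup_minSmoothness (G : Type*) [TopologicalSpace G] [ChartedSpace E G] [Group G]
    [LieGroup 𝓘(ℝ, E) ∞ G] : LieGroup 𝓘(ℝ, E) (minSmoothness ℝ 3) G :=
  LieGroup.of_le (n := ∞) (by rw [minSmoothness_of_isRCLikeNormedField]; exact ENat.LEInfty.out)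

/-- `ad ξ : 𝔤 → 𝔤*` for `ξ ∈ 𝔤*`, given by `⟨ad ξ (x), y⟩ = ⟨ξ, [x, y]⟩`. -/
def ad (G : Type*) [TopologicalSpace G] [ChartedSpace E G] [Group G] [LieGroup 𝓘(ℝ, E) ∞ G]
    (ξ : E →L[ℝ] ℝ) : E →L[ℝ] (E →L[ℝ] ℝ) :=
  LinearMap.toContinuousLinearMap
    { toFun := fun x => LinearMap.toContinuousLinearMap
        { toFun := fun y => ξ (lieBr G x y)
          map_add' := by
            have := lieGroup_minSmoothness (E := E) G
            intro y z
            rw [← map_add]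
            exact congrArg ξ (lie_add (L := GroupLieAlgebra 𝓘(ℝ, E) G) (M := GroupLieAlgebra 𝓘(ℝ, E) G) _ _ _)
          map_smul' := by
            have := lieGroup_minSmoothness (E := E) G
            intro c y
            rw [RingHom.id_apply, ← map_smul]
            exact congrArg ξ (lie_smul (R := ℝ) (L := GroupLieAlgebra 𝓘(ℝ, E) G)
              (M := GroupLieAlgebra 𝓘(ℝ, E) G) _ _ _) }
      map_add' := by
        have := lieGroup_minSmoothness (E := E) G
        intro x z
        ext y
        change ξ _ = ξ _ + ξ _
        rw [← map_add]
        exact congrArg ξ (add_lie (L := GroupLieAlgebra 𝓘(ℝ, E) G) (M := GroupLieAlgebra 𝓘(ℝ, E) G) _ _ _)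
      map_smul' := by
        have := lieGroup_minSmoothness (E := E) G
        intro c x
        ext y
        change ξ _ = c • ξ _
        rw [← map_smul]
        exact congrArg ξ (smul_lie (R := ℝ) (L := GroupLieAlgebra 𝓘(ℝ, E) G)
              (M := GroupLieAlgebra 𝓘(ℝ, E) G) _ _ _) }

/-- The model with corners of `P = G × 𝔤`. -/
abbrev IP (E : Type*) [NormedAddCommGroup E] [NormedSpace ℝ E] :
    ModelWithCorners ℝ (E × E) (ModelProd E E) :=
  𝓘(ℝ, E).prod 𝓘(ℝ, E)

/-- The tangent space of `P = G × 𝔤` at `p`. -/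
abbrev TP (p : G × E) : Type _ := TangentSpace (IP E) p

/-- The left action of `g ∈ G` on the trivial principal bundle `P = G × 𝔤`. -/
def act (g : G) (p : G × E) : G × E := (g * p.1, p.2)

/-- The differential of the action of `g` at `p`. -/
def dAct (g : G) (p : G × E) : TP p →L[ℝ] TP (act g p) :=
  mfderiv (IP E) (IP E) (act g) p

/-- The fundamental vector field `ρ*` on `P`: the differential at `g = 1` of `g ↦ g · p`,
applied to `ρ ∈ 𝔤`. -/
def fund (ρ : E) (p : G × E) : TP p :=
  (mfderiv 𝓘(ℝ, E) (IP E) (fun g : G => act g p) 1 : E →L[ℝ] E × E) ρ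

/-- Smoothness of a `𝔤`-valued `1`-form on `P`: it is smooth as a function on `TP`. -/
def SmoothForm [LieGroup 𝓘(ℝ, E) ∞ G] (α : (p : G × E) → TP p →L[ℝ] E) : Prop :=
  ContMDiff (IP E).tangent 𝓘(ℝ, E) ∞ (fun v : TangentBundle (IP E) (G × E) => α v.1 v.2)

/-- A `1`-form on `P` with values in a vector space is non-degenerate if only vertical vectors
are in its kernel. -/
def Nondegenerate {W : Type*} [NormedAddCommGroup W] [NormedSpace ℝ W]
    (α : (p : G × E) → TP p →L[ℝ] W) : Prop :=
  ∀ (p : G × E) (X : TP p), α p X = 0 → ∃ ρ : E, X = fund ρ p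

/-- `θ` is a (smooth) connection `1`-form on the left principal `G`-bundle `P`. -/
structure IsConnectionForm [LieGroup 𝓘(ℝ, E) ∞ G] (θ : (p : G × E) → TP p →L[ℝ] E) : Prop where
  smooth : SmoothForm θ
  equivariant : ∀ (g : G) (p : G × E) (X : TP p), θ (act g p) (dAct g p X) = Ad g (θ p X)
  fund : ∀ (ρ : E) (p : G × E), θ p (fund ρ p) = ρ

/-- `L` is a (smooth) non-degenerate horizontal `ad G`-valued `1`-form on `P`. -/
structure IsNondegHorizontalForm [LieGroup 𝓘(ℝ, E) ∞ G] (L : (p : G × E) → TP p →L[ℝ] E) :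
    Prop where
  smooth : SmoothForm L
  equivariant : ∀ (g : G) (p : G × E) (X : TP p), L (act g p) (dAct g p X) = Ad g (L p X)
  horizontal : ∀ (ρ : E) (p : G × E), L p (KahlerGC.fund ρ p) = 0
  nondegenerate : Nondegenerate L

/-- The almost complex structure `I` on `P` defined by `(θ, L)`: `I X` is the unique vector with
`θ (I X) = -L X` and `L (I X) = θ X`. Thus `I ρ*` is the horizontal `Y` with `L Y = ρ`, and
`θ (ρ* + I σ*) = ρ`, `L (ρ* + I σ*) = σ`. -/
def cplx (θ L : (p : G × E) → TP p →L[ℝ] E) (p : G × E) : TP p →L[ℝ] TP p :=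
  ((θ p).prod (L p)).inverse.comp ((-(L p)).prod (θ p))

/-- `μ : P → 𝔤*` is (smooth and) `G`-equivariant. -/
structure IsSmoothEquivariant (μ : G × E → (E →L[ℝ] ℝ)) : Prop where
  smooth : ContMDiff (IP E) 𝓘(ℝ, E →L[ℝ] ℝ) ∞ μ
  equivariant : ∀ (g : G) (p : G × E), μ (act g p) = coAd g (μ p)

/-- The differential of `μ : P → 𝔤*`. -/
def dMap (μ : G × E → (E →L[ℝ] ℝ)) (p : G × E) : TP p →L[ℝ] (E →L[ℝ] ℝ) :=
  (mfderiv (IP E) 𝓘(ℝ, E →L[ℝ] ℝ) μ p : _)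

/-- The covariant derivative `Dμ = dμ + [μ, θ]`, where `⟨[μ, x], y⟩ = ⟨μ, [x, y]⟩`. -/
def covDeriv [LieGroup 𝓘(ℝ, E) ∞ G] (θ : (p : G × E) → TP p →L[ℝ] E) (μ : G × E → (E →L[ℝ] ℝ))
    (p : G × E) : TP p →L[ℝ] (E →L[ℝ] ℝ) :=
  dMap μ p + (ad G (μ p)).comp (θ p)

/-- The equivariant map `μ` is regular: its covariant derivative, which vanishes on vertical
vectors, is non-degenerate. -/
def IsRegular [LieGroup 𝓘(ℝ, E) ∞ G] (θ : (p : G × E) → TP p →L[ℝ] E)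
    (μ : G × E → (E →L[ℝ] ℝ)) : Prop :=
  Nondegenerate (covDeriv θ μ)

/-- Smooth Riemannian metrics on `P`. -/
abbrev Metric (E G : Type*) [NormedAddCommGroup E] [NormedSpace ℝ E]
    [TopologicalSpace G] [ChartedSpace E G] [Group G] [LieGroup 𝓘(ℝ, E) ∞ G] : Type _ :=
  Bundle.ContMDiffRiemannianMetric (IP E) ∞ (E × E) (fun p : G × E => TP p)

/-- `g` is a `G`-invariant Kähler metric, with Kähler form `κ = g(I ·, ·)`, for the complex
structure `I` on `P`. (Integrability of `I` is a property of `I` alone, see `IsIntegrable`.) -/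
structure IsInvariantKahler [LieGroup 𝓘(ℝ, E) ∞ G]
    (I : (p : G × E) → TP p →L[ℝ] TP p) (g : Metric E G)
    (κ : DiffForm (IP E) (M := G × E) 2) : Prop where
  invariant : ∀ (a : G) (p : G × E) (X Y : TP p),
    g.inner (act a p) (dAct a p X) (dAct a p Y) = g.inner p X Y
  hermitian : ∀ (p : G × E) (X Y : TP p), g.inner p (I p X) (I p Y) = g.inner p X Y
  kahlerForm : ∀ (p : G × E) (X Y : TP p), κ p ![X, Y] = g.inner p (I p X) Y
  closed : κ.d = 0

/-- The moment map condition `d⟨μ, ρ⟩ = κ(ρ*, ·)` for an equivariant `μ : P → 𝔤*`. -/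
def IsMomentMap (μ : G × E → (E →L[ℝ] ℝ)) (κ : DiffForm (IP E) (M := G × E) 2) : Prop :=
  ∀ (ρ : E) (p : G × E) (X : TP p), dMap μ p X ρ = κ p ![fund ρ p, X]

/-- The real-valued `1`-form `⟨μ, θ⟩` on `P`. -/
def pairing (μ : G × E → (E →L[ℝ] ℝ)) (θ : (p : G × E) → TP p →L[ℝ] E) :
    DiffForm (IP E) (M := G × E) 1 :=
  fun p => ContinuousAlternatingMap.ofSubsingleton ℝ (TP p) ℝ (0 : Fin 1) ((μ p).comp (θ p))

/-- The bilinear form `⟨x, Φ y⟩` on `𝔤*` given by `Φ : 𝔤* → 𝔤` is symmetric. -/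
def SymmForm (Φ : (E →L[ℝ] ℝ) →L[ℝ] E) : Prop := ∀ x y : E →L[ℝ] ℝ, x (Φ y) = y (Φ x)

/-- The bilinear form `⟨x, Φ y⟩` on `𝔤*` given by `Φ : 𝔤* → 𝔤` is positive on nonzero vectors. -/
def PosDefForm (Φ : (E →L[ℝ] ℝ) →L[ℝ] E) : Prop := ∀ x : E →L[ℝ] ℝ, x ≠ 0 → 0 < x (Φ x)

end KahlerGC

end

/-!
A tangent vector with `θ X = ρ` and `L X = σ` is `X = ρ* + I σ*`. If `g` is a Kähler metric with
moment map `μ`, the moment map condition together with the invariance of `g` under `I` therefore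
forces `g(X, Y) = ⟨dμ(Y), σ⟩ + ⟨dμ(I Y), ρ⟩`, so there is only one candidate. It is symmetric if
and only if `Φ` is, and completing the square in `g(X, X)` produces the two positivity conditions.

Equivariance determines the brackets of the fields `ρ*` with the frame `ρ* + I σ*`, and the
vanishing of the Nijenhuis tensor then determines the brackets `[I ρ*, I σ*]`. The resulting
curvature identity `dθ(X, Y) = [θ X, θ Y] - [L X, L Y]` shows that, for symmetric `Φ`, the form
`g(I ·, ·)` of the candidate is `-d⟨μ, θ⟩`, which is closed.
-/

noncomputable section

namespace KahlerGC

open Filter Topology VectorField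

/-! ### One-forms and vector fields in charts -/

section Chart

variable {V : Type*} [NormedAddCommGroup V] [NormedSpace ℝ V]
  {W : Type*} [NormedAddCommGroup W] [NormedSpace ℝ W]
  {H : Type*} [TopologicalSpace H] (J : ModelWithCorners ℝ V H)
  {M : Type*} [TopologicalSpace M] [ChartedSpace H M]

/-- The expression of a vector-valued one-form in the preferred chart at `p₀`. -/
def formInChart (α : (q : M) → TangentSpace J q →L[ℝ] W) (p₀ : M) (y : V) : V →L[ℝ] W :=
  (α ((extChartAt J p₀).symm y)).comp
    (mfderiv 𝓘(ℝ, V) J (extChartAt J p₀).symm y :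
      V →L[ℝ] TangentSpace J ((extChartAt J p₀).symm y))

/-- The expression of a vector field in the preferred chart at `p₀`. -/
def fieldInChart (X : (q : M) → TangentSpace J q) (p₀ : M) (y : V) : V :=
  mfderiv J 𝓘(ℝ, V) (extChartAt J p₀) ((extChartAt J p₀).symm y) (X ((extChartAt J p₀).symm y))

variable {J}

theorem fieldInChart_extChartAt (X : (q : M) → TangentSpace J q) {p₀ q : M}
    (hq : q ∈ (extChartAt J p₀).source) :
    fieldInChart J X p₀ (extChartAt J p₀ q) = mfderiv J 𝓘(ℝ, V) (extChartAt J p₀) q (X q) := by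
  have h (q' : M) (h : q' = q) : mfderiv J 𝓘(ℝ, V) (extChartAt J p₀) q' (X q') =
      mfderiv J 𝓘(ℝ, V) (extChartAt J p₀) q (X q) := by subst h; rfl
  exact h _ ((extChartAt J p₀).left_inv hq)

section

variable [IsManifold J 1 M]

theorem fieldInChart_self (X : (q : M) → TangentSpace J q) (p : M) :
    fieldInChart J X p (extChartAt J p p) = X p := by
  rw [fieldInChart_extChartAt X (mem_extChartAt_source p), mfderiv_extChartAt_self]
  rfl

theorem trivializationAt_eventuallyEq_fieldInChart (X : (q : M) → TangentSpace J q) (p : M) :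
    (fun q => (trivializationAt V (TangentSpace J) p ⟨q, X q⟩).2) =ᶠ[𝓝 p]
      fun q => fieldInChart J X p (extChartAt J p q) := by
  filter_upwards [extChartAt_source_mem_nhds (I := J) p] with q hq
  rw [fieldInChart_extChartAt X hq]
  rw [extChartAt_source] at hq
  have h := congrFun ((trivializationAt V (TangentSpace J) p).coe_linearMapAt_of_mem
    (R := ℝ) (b := q) hq) (X q)
  exact h.symm.trans
    (DFunLike.congr_fun (TangentBundle.continuousLinearMapAt_trivializationAt hq) (X q))

end

theorem contMDiffAt_of_fieldInChart [IsManifold J ∞ M] {X : (q : M) → TangentSpace J q} {p : M}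
    (hX : ContDiffAt ℝ ∞ (fieldInChart J X p) (extChartAt J p p)) :
    ContMDiffAt J J.tangent ∞ (fun q => (⟨q, X q⟩ : TangentBundle J M)) p :=
  Bundle.contMDiffAt_totalSpace.2 ⟨contMDiffAt_id,
    (hX.contMDiffAt.comp p contMDiffAt_extChartAt).congr_of_eventuallyEq
      (trivializationAt_eventuallyEq_fieldInChart X p)⟩

variable [J.Boundaryless]

theorem extChartAt_target_mem_nhds_self (p : M) :
    (extChartAt J p).target ∈ 𝓝 (extChartAt J p p) :=
  (isOpen_extChartAt_target p).mem_nhds (mem_extChartAt_target p)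

section

variable [IsManifold J 1 M]

theorem mfderiv_extChartAt_symm_self (p : M) :
    mfderiv 𝓘(ℝ, V) J (extChartAt J p).symm (extChartAt J p p) = ContinuousLinearMap.id ℝ V := by
  have h := mfderivWithin_range_extChartAt_symm (I := J) (x := p)
  rwa [J.range_eq_univ, mfderivWithin_univ] at h

theorem mdifferentiableAt_extChartAt_symm' {p₀ : M} {y : V} (hy : y ∈ (extChartAt J p₀).target) :
    MDifferentiableAt 𝓘(ℝ, V) J (extChartAt J p₀).symm y := by
  have h := mdifferentiableWithinAt_extChartAt_symm (I := J) hy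
  rwa [J.range_eq_univ, mdifferentiableWithinAt_univ] at h

theorem mfderiv_extChartAt_symm_comp_mfderiv_extChartAt {p₀ q : M}
    (hq : q ∈ (extChartAt J p₀).source) :
    (mfderiv 𝓘(ℝ, V) J (extChartAt J p₀).symm (extChartAt J p₀ q)).comp
      (mfderiv J 𝓘(ℝ, V) (extChartAt J p₀) q) = ContinuousLinearMap.id ℝ (TangentSpace J q) := by
  have h := mfderivWithin_extChartAt_symm_comp_mfderiv_extChartAt' (I := J) hq
  rwa [J.range_eq_univ, mfderivWithin_univ] at h

theorem isInvertible_mfderiv_extChartAt_symm {p₀ : M} {y : V}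
    (hy : y ∈ (extChartAt J p₀).target) :
    (mfderiv 𝓘(ℝ, V) J (extChartAt J p₀).symm y).IsInvertible := by
  have h := isInvertible_mfderivWithin_extChartAt_symm (I := J) hy
  rwa [J.range_eq_univ, mfderivWithin_univ] at h

theorem formInChart_self (α : (q : M) → TangentSpace J q →L[ℝ] W) (p : M) :
    formInChart J α p (extChartAt J p p) = α p := by
  have h (q : M) (hq : q = p) : (α q).comp (ContinuousLinearMap.id ℝ V) = α p := by subst hq; rfl
  rw [formInChart, mfderiv_extChartAt_symm_self]
  exact h _ (extChartAt_to_inv p)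

theorem mfderiv_extChartAt_symm_fieldInChart (X : (q : M) → TangentSpace J q) {p₀ : M} {y : V}
    (hy : y ∈ (extChartAt J p₀).target) :
    mfderiv 𝓘(ℝ, V) J (extChartAt J p₀).symm y (fieldInChart J X p₀ y : V) =
      X ((extChartAt J p₀).symm y) := by
  have h := mfderiv_extChartAt_symm_comp_mfderiv_extChartAt (J := J)
    ((extChartAt J p₀).map_target hy)
  rw [(extChartAt J p₀).right_inv hy] at h
  exact DFunLike.congr_fun h _

theorem formInChart_fieldInChart (α : (q : M) → TangentSpace J q →L[ℝ] W)
    (X : (q : M) → TangentSpace J q) {p₀ : M} {y : V} (hy : y ∈ (extChartAt J p₀).target) :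
    formInChart J α p₀ y (fieldInChart J X p₀ y) =
      α ((extChartAt J p₀).symm y) (X ((extChartAt J p₀).symm y)) :=
  congrArg (α _) (mfderiv_extChartAt_symm_fieldInChart X hy)

theorem mpullback_extChartAt_symm_eventuallyEq (X : (q : M) → TangentSpace J q) (p : M) :
    mpullback 𝓘(ℝ, V) J (extChartAt J p).symm X =ᶠ[𝓝 (extChartAt J p p)] fieldInChart J X p := by
  filter_upwards [extChartAt_target_mem_nhds_self p] with y hy
  exact (isInvertible_mfderiv_extChartAt_symm hy).inverse_apply_eq.2
    (mfderiv_extChartAt_symm_fieldInChart X hy).symm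

theorem mlieBracket_eq_lieBracket_fieldInChart (X Y : (q : M) → TangentSpace J q) (p : M) :
    mlieBracket J X Y p =
      lieBracket ℝ (fieldInChart J X p) (fieldInChart J Y p) (extChartAt J p p) := by
  have h := mlieBracketWithin_apply (I := J) (V := X) (W := Y) (s := Set.univ) (x₀ := p)
  simp only [mfderiv_extChartAt_self, J.range_eq_univ, Set.preimage_univ, Set.univ_inter,
    mpullbackWithin_univ, mlieBracketWithin_univ] at h
  refine h.trans
    ((DFunLike.congr_fun (ContinuousLinearMap.inverse_id (R := ℝ) (M := V)) _).trans ?_)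
  exact (congrFun lieBracketWithin_univ _).trans
    ((mpullback_extChartAt_symm_eventuallyEq X p).lieBracket_vectorField_eq
      (mpullback_extChartAt_symm_eventuallyEq Y p))

theorem differentiableAt_fieldInChart {X : (q : M) → TangentSpace J q} {p : M}
    (hX : MDifferentiableAt J J.tangent (fun q => (⟨q, X q⟩ : TangentBundle J M)) p) :
    DifferentiableAt ℝ (fieldInChart J X p) (extChartAt J p p) := by
  have h := ((mdifferentiableAt_totalSpace J _).1 hX).2.congr_of_eventuallyEq
    (trivializationAt_eventuallyEq_fieldInChart X p).symm
  have h' := h.comp_of_eq (extChartAt J p p)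
    (mdifferentiableAt_extChartAt_symm' (mem_extChartAt_target p)) (extChartAt_to_inv p)
  refine h'.differentiableAt.congr_of_eventuallyEq ?_
  filter_upwards [extChartAt_target_mem_nhds_self p] with y hy
  exact congrArg (fieldInChart J X p) ((extChartAt J p).right_inv hy).symm

end

variable [IsManifold J ∞ M] [FiniteDimensional ℝ V]

theorem contDiffOn_formInChart {α : (q : M) → TangentSpace J q →L[ℝ] W}
    (hα : ContMDiff J.tangent 𝓘(ℝ, W) ∞ (fun v : TangentBundle J M => α v.1 v.2)) (p₀ : M) :
    ContDiffOn ℝ ∞ (formInChart J α p₀) (extChartAt J p₀).target := by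
  rw [contDiffOn_clm_apply]
  intro v
  have hU : IsOpen (extChartAt J p₀).target := isOpen_extChartAt_target p₀
  have htangent := (contMDiffOn_extChartAt_symm (I := J) (n := ∞) p₀).contMDiffOn_tangentMapWithin
    (m := ∞) (by simp) hU.uniqueMDiffOn
  have hconst : ContMDiff 𝓘(ℝ, V) 𝓘(ℝ, V).tangent ∞
      (fun y : V => (⟨y, v⟩ : TangentBundle 𝓘(ℝ, V) V)) := fun y =>
    Bundle.contMDiffAt_totalSpace.2 ⟨contMDiffAt_id, by simpa using contMDiffAt_const⟩
  have h := (hα.comp_contMDiffOn htangent).comp hconst.contMDiffOn (s := (extChartAt J p₀).target)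
    (fun y hy => hy)
  refine contMDiffOn_iff_contDiffOn.1 (h.congr fun y hy => ?_)
  simp only [Function.comp, tangentMapWithin, mfderivWithin_of_isOpen hU hy]
  rfl

theorem contDiffAt_formInChart {α : (q : M) → TangentSpace J q →L[ℝ] W}
    (hα : ContMDiff J.tangent 𝓘(ℝ, W) ∞ (fun v : TangentBundle J M => α v.1 v.2)) (p : M) :
    ContDiffAt ℝ ∞ (formInChart J α p) (extChartAt J p p) :=
  (contDiffOn_formInChart hα p).contDiffAt (extChartAt_target_mem_nhds_self p)

theorem contDiffAt_inverse_formInChart {α : (q : M) → TangentSpace J q →L[ℝ] W}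
    (hα : ContMDiff J.tangent 𝓘(ℝ, W) ∞ (fun v : TangentBundle J M => α v.1 v.2)) {p : M}
    (hinv : (α p).IsInvertible) :
    ContDiffAt ℝ ∞ (fun y => (formInChart J α p y).inverse) (extChartAt J p p) := by
  have : CompleteSpace V := FiniteDimensional.complete ℝ V
  refine ContDiffAt.comp _ (ContinuousLinearMap.IsInvertible.contDiffAt_map_inverse ?_)
    (contDiffAt_formInChart hα p)
  rw [formInChart_self]
  exact hinv

theorem contMDiff_inverse_apply {α : (q : M) → TangentSpace J q →L[ℝ] W}
    (hα : ContMDiff J.tangent 𝓘(ℝ, W) ∞ (fun v : TangentBundle J M => α v.1 v.2))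
    (hinv : ∀ q, (α q).IsInvertible) (w : W) :
    ContMDiff J J.tangent ∞ (fun q => (⟨q, (α q).inverse w⟩ : TangentBundle J M)) := fun p => by
  refine contMDiffAt_of_fieldInChart (((contDiffAt_inverse_formInChart hα (hinv p)).clm_apply
    contDiffAt_const).congr_of_eventuallyEq ?_ (f := fun y => (formInChart J α p y).inverse w))
  filter_upwards [extChartAt_target_mem_nhds_self p] with y hy
  exact (((hinv _).comp (isInvertible_mfderiv_extChartAt_symm hy)).inverse_apply_eq.2
    ((formInChart_fieldInChart α (fun q => (α q).inverse w) hy).trans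
      ((hinv _).self_apply_inverse w)).symm).symm

end Chart

/-! ### Lie brackets and smooth actions -/

section LocalAction

variable {S V W : Type*} [NormedAddCommGroup S] [NormedSpace ℝ S] [NormedAddCommGroup V]
  [NormedSpace ℝ V] [NormedAddCommGroup W] [NormedSpace ℝ W]

theorem differentiableAt_clm_of_apply [FiniteDimensional ℝ W] {f : S → W →L[ℝ] V} {x : S}
    (hf : ∀ w, DifferentiableAt ℝ (fun y => f y w) x) : DifferentiableAt ℝ f x := by
  let b := Module.finBasis ℝ W
  have hsum : f = fun y => ∑ i, (b.coord i).toContinuousLinearMap.smulRight (f y (b i)) := by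
    ext y w
    conv_lhs => rw [← b.sum_repr w, map_sum]
    simp
  rw [hsum]
  fun_prop

/-- Both the bracket and the derivative in `s` of the equivariance `F(s, ·)_* X_w = X_{A(s) w}`
contain the mixed second derivative of `F`; comparing them eliminates it. -/
theorem lieBracket_eq_neg_of_localAction {F : S × V → V} {e ρ : S} {y₀ : V}
    (hF : ContDiffAt ℝ ∞ F (e, y₀)) {Z : V → V}
    (hZ : ∀ᶠ y in 𝓝 y₀, fderiv ℝ F (e, y) (ρ, 0) = Z y) (hFe : F (e, y₀) = y₀)
    {X : V → W →L[ℝ] V} (hX : DifferentiableAt ℝ X y₀) {A : S → W →L[ℝ] W}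
    {A' : S →L[ℝ] W →L[ℝ] W} (hA : HasFDerivAt A A' e) (hAe : A e = .id ℝ W) {w : W}
    (hequiv : ∀ᶠ s in 𝓝 e, fderiv ℝ F (s, y₀) (0, X y₀ w) = X (F (s, y₀)) (A s w)) :
    lieBracket ℝ Z (fun y => X y w) y₀ = -X y₀ (A' ρ w) := by
  have hDF : HasFDerivAt F (fderiv ℝ F (e, y₀)) (e, y₀) :=
    (hF.differentiableAt (by simp)).hasFDerivAt
  have hDDF : HasFDerivAt (fderiv ℝ F) (fderiv ℝ (fderiv ℝ F) (e, y₀)) (e, y₀) :=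
    ((hF.fderiv_right (m := ∞) (by simp)).differentiableAt (by simp)).hasFDerivAt
  have hsymm := (hF.isSymmSndFDerivAt
    (by rw [minSmoothness_of_isRCLikeNormedField]; exact ENat.LEInfty.out)).eq
    (ρ, (0 : V)) ((0 : S), X y₀ w)
  have hDFy : HasFDerivAt (fun y => fderiv ℝ F (e, y)) _ y₀ :=
    hDDF.comp y₀ (hasFDerivAt_prodMk_right e y₀)
  have hZ' := (hDFy.clm_apply (hasFDerivAt_const (ρ, (0 : V)) y₀)).congr_of_eventuallyEq
    (hZ.mono fun y hy => hy.symm)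
  have hDFs : HasFDerivAt (fun s => fderiv ℝ F (s, y₀)) _ e :=
    hDDF.comp e (hasFDerivAt_prodMk_left e y₀)
  have hleft := hDFs.clm_apply (hasFDerivAt_const ((0 : S), X y₀ w) e)
  have hX' : HasFDerivAt X (fderiv ℝ X y₀) (F (e, y₀)) := by rw [hFe]; exact hX.hasFDerivAt
  have hXF : HasFDerivAt (fun s => X (F (s, y₀))) _ e :=
    hX'.comp e (hDF.comp e (hasFDerivAt_prodMk_left e y₀))
  have hright := hXF.clm_apply
    (hA.clm_apply (hasFDerivAt_const w e))
  have hmixed := DFunLike.congr_fun (hleft.unique (hright.congr_of_eventuallyEq hequiv)) ρ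
  have hmixed' : fderiv ℝ (fderiv ℝ F) (e, y₀) (ρ, 0) (0, X y₀ w) =
      X y₀ (A' ρ w) + fderiv ℝ X y₀ (Z y₀) w := by
    simpa [hFe, hAe, hZ.self_of_nhds] using hmixed
  have hZw : fderiv ℝ Z y₀ (X y₀ w) =
      fderiv ℝ (fderiv ℝ F) (e, y₀) (0, X y₀ w) (ρ, 0) := by
    rw [hZ'.fderiv]
    simp
  have hXw : fderiv ℝ (fun y => X y w) y₀ (Z y₀) = fderiv ℝ X y₀ (Z y₀) w := by
    rw [fderiv_clm_apply hX (differentiableAt_const w)]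
    simp
  rw [lieBracket, hXw, hZw, ← hsymm, hmixed']
  abel

theorem fderiv_prodMk_apply_left {F : S × V → W} {s : S} {y : V}
    (hF : DifferentiableAt ℝ F (s, y)) (v : S) :
    fderiv ℝ F (s, y) (v, 0) = fderiv ℝ (fun s => F (s, y)) s v := by
  have h : HasFDerivAt (fun s => F (s, y)) _ s :=
    hF.hasFDerivAt.comp s (hasFDerivAt_prodMk_left s y)
  exact (DFunLike.congr_fun h.fderiv v).symm

theorem fderiv_prodMk_apply_right {F : S × V → W} {s : S} {y : V}
    (hF : DifferentiableAt ℝ F (s, y)) (v : V) :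
    fderiv ℝ F (s, y) (0, v) = fderiv ℝ (fun y => F (s, y)) y v := by
  have h : HasFDerivAt (fun y => F (s, y)) _ y :=
    hF.hasFDerivAt.comp y (hasFDerivAt_prodMk_right s y)
  exact (DFunLike.congr_fun h.fderiv v).symm

end LocalAction

section ChartAction

variable {V : Type*} [NormedAddCommGroup V] [NormedSpace ℝ V]
  {H : Type*} [TopologicalSpace H] {J : ModelWithCorners ℝ V H}
  {M : Type*} [TopologicalSpace M] [ChartedSpace H M]
  {S : Type*} [NormedAddCommGroup S] [NormedSpace ℝ S]
  {K : Type*} [TopologicalSpace K] {JN : ModelWithCorners ℝ S K}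
  {N : Type*} [TopologicalSpace N] [ChartedSpace K N]

variable (J JN) in
/-- A smooth family of maps `a s : M → M`, `s ∈ N`, near `(e, p)`, in the preferred charts. -/
def familyInChart (a : N → M → M) (e : N) (p : M) (z : S × V) : V :=
  extChartAt J p (a ((extChartAt JN e).symm z.1) ((extChartAt J p).symm z.2))

theorem familyInChart_extChartAt (a : N → M → M) (e : N) (p : M) (s : S) :
    familyInChart J JN a e p (s, extChartAt J p p) =
      extChartAt J p (a ((extChartAt JN e).symm s) p) := by
  rw [familyInChart, extChartAt_to_inv]

variable [IsManifold J ∞ M] [JN.Boundaryless]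

theorem fderiv_extChartAt_comp_extChartAt_symm {f : N → M} {x : N} {p : M}
    (hf : MDifferentiableAt JN J f x) (hx : f x ∈ (extChartAt J p).source) (v : S) :
    fderiv ℝ (fun s => extChartAt J p (f ((extChartAt JN x).symm s))) (extChartAt JN x x) v =
      mfderiv J 𝓘(ℝ, V) (extChartAt J p) (f x) (mfderiv JN J f x v) := by
  have : IsManifold J 1 M := IsManifold.of_le (n := ∞) (by simp)
  have hφ : HasMFDerivAt J 𝓘(ℝ, V) (extChartAt J p) (f x) _ :=
    (mdifferentiableAt_extChartAt (by rwa [← extChartAt_source J])).hasMFDerivAt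
  let D : S →L[ℝ] V := (mfderiv J 𝓘(ℝ, V) (extChartAt J p) (f x)).comp (mfderiv JN J f x)
  have h : HasFDerivAt (fun s => extChartAt J p (f ((extChartAt JN x).symm s))) D
      (extChartAt JN x x) :=
    (hφ.comp x hf.hasMFDerivAt).2.hasFDerivAt (by simp [JN.range_eq_univ])
  exact DFunLike.congr_fun h.fderiv v

variable [J.Boundaryless] [IsManifold JN ∞ N] {a : N → M → M} {e : N}
  (ha : ContMDiff (JN.prod J) J ∞ (fun x : N × M => a x.1 x.2)) (hae : ∀ q, a e q = q)

include ha hae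

theorem contDiffAt_familyInChart (p : M) :
    ContDiffAt ℝ ∞ (familyInChart J JN a e p) (extChartAt JN e e, extChartAt J p p) := by
  have hψ := (contMDiffOn_extChartAt_symm (I := JN) (n := ∞) e).contMDiffAt
    (extChartAt_target_mem_nhds_self e)
  have hφ := (contMDiffOn_extChartAt_symm (I := J) (n := ∞) p).contMDiffAt
    (extChartAt_target_mem_nhds_self p)
  have hsymm := (hψ.comp (extChartAt JN e e, extChartAt J p p) contDiffAt_fst.contMDiffAt).prodMk
    (hφ.comp (extChartAt JN e e, extChartAt J p p) contDiffAt_snd.contMDiffAt)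
  have hchart : ContMDiffAt J 𝓘(ℝ, V) ∞ (extChartAt J p) (a e p) := by
    rw [hae]
    exact contMDiffAt_extChartAt
  have hcomp : ContMDiffAt (JN.prod J) 𝓘(ℝ, V) ∞ (fun x : N × M => extChartAt J p (a x.1 x.2))
      (e, p) := hchart.comp (e, p) ha.contMDiffAt
  exact (hcomp.comp_of_eq hsymm (by simp)).contDiffAt

theorem eventually_differentiableAt_familyInChart (p : M) :
    ∀ᶠ z in 𝓝 (extChartAt JN e e, extChartAt J p p),
      DifferentiableAt ℝ (familyInChart J JN a e p) z :=
  (((contDiffAt_familyInChart ha hae p).of_le (m := 1) (by simp)).eventually (by simp)).mono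
    fun z hz => hz.differentiableAt (by simp)

theorem eventually_fderiv_familyInChart_left (p : M) (ρ : S) :
    ∀ᶠ y in 𝓝 (extChartAt J p p),
      fderiv ℝ (familyInChart J JN a e p) (extChartAt JN e e, y) (ρ, 0) =
        fieldInChart J (fun q => mfderiv JN J (fun s => a s q) e ρ) p y := by
  filter_upwards [(Continuous.prodMk_right (extChartAt JN e e)).continuousAt.eventually
    (eventually_differentiableAt_familyInChart ha hae p), extChartAt_target_mem_nhds_self p]
    with y hdiff hy
  have hay : MDifferentiableAt JN J (fun s => a s ((extChartAt J p).symm y)) e :=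
    (ha.comp (contMDiff_id.prodMk contMDiff_const)).mdifferentiable (by simp) e
  have hsource : a e ((extChartAt J p).symm y) ∈ (extChartAt J p).source := by
    rw [hae]
    exact (extChartAt J p).map_target hy
  refine (fderiv_prodMk_apply_left hdiff ρ).trans
    ((fderiv_extChartAt_comp_extChartAt_symm hay hsource ρ).trans ?_)
  exact congrArg (fun q => (mfderiv J 𝓘(ℝ, V) (extChartAt J p) q : V →L[ℝ] V)
    (mfderiv JN J (fun s => a s ((extChartAt J p).symm y)) e ρ)) (hae _)

theorem eventually_fderiv_familyInChart_right (p : M) :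
    ∀ᶠ s in 𝓝 (extChartAt JN e e), a ((extChartAt JN e).symm s) p ∈ (extChartAt J p).source ∧
      ∀ v : V, fderiv ℝ (familyInChart J JN a e p) (s, extChartAt J p p) (0, v) =
        mfderiv J 𝓘(ℝ, V) (extChartAt J p) (a ((extChartAt JN e).symm s) p)
          (mfderiv J J (a ((extChartAt JN e).symm s)) p v) := by
  have hcont : ContinuousAt (fun s => a ((extChartAt JN e).symm s) p) (extChartAt JN e e) :=
    (ha.continuous.comp (Continuous.prodMk_left p)).continuousAt.comp
      (continuousAt_extChartAt_symm e)
  have hnhds : (extChartAt J p).source ∈ 𝓝 (a ((extChartAt JN e).symm (extChartAt JN e e)) p) := by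
    rw [extChartAt_to_inv, hae]
    exact extChartAt_source_mem_nhds p
  filter_upwards [(Continuous.prodMk_left (extChartAt J p p)).continuousAt.eventually
    (eventually_differentiableAt_familyInChart ha hae p), hcont.eventually hnhds] with s hdiff hs
  have has : MDifferentiableAt J J (a ((extChartAt JN e).symm s)) p :=
    (ha.comp (contMDiff_const.prodMk contMDiff_id)).mdifferentiable (by simp) p
  exact ⟨hs, fun v => (fderiv_prodMk_apply_right hdiff v).trans
    (fderiv_extChartAt_comp_extChartAt_symm has hs v)⟩

theorem mlieBracket_eq_neg_of_equivariant {W : Type*} [NormedAddCommGroup W] [NormedSpace ℝ W]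
    [FiniteDimensional ℝ W] {X : (q : M) → W →L[ℝ] TangentSpace J q} {p : M}
    (hX : ∀ w, MDifferentiableAt J J.tangent (fun q => (⟨q, X q w⟩ : TangentBundle J M)) p)
    {A : N → W →L[ℝ] W} {A' : S →L[ℝ] W →L[ℝ] W}
    (hA : HasMFDerivAt JN 𝓘(ℝ, W →L[ℝ] W) A e A') (hAe : A e = .id ℝ W)
    (hequiv : ∀ s w, mfderiv J J (a s) p (X p w) = X (a s p) (A s w)) (ρ : S) (w : W) :
    mlieBracket J (fun q => (mfderiv JN J (fun s => a s q) e ρ : TangentSpace J (a e q)))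
      (fun q => X q w) p = -X p (A' ρ w) := by
  have : IsManifold J 1 M := IsManifold.of_le (n := ∞) (by simp)
  let X' : V → W →L[ℝ] V := fun y =>
    (mfderiv J 𝓘(ℝ, V) (extChartAt J p) ((extChartAt J p).symm y)).comp
      (X ((extChartAt J p).symm y))
  have hX' : DifferentiableAt ℝ X' (extChartAt J p p) :=
    differentiableAt_clm_of_apply fun w => differentiableAt_fieldInChart (hX w)
  have hX'self (w : W) : X' (extChartAt J p p) w = X p w :=
    fieldInChart_self (fun q => X q w) p
  have hA' : HasFDerivAt (fun s => A ((extChartAt JN e).symm s)) A' (extChartAt JN e e) :=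
    hA.2.hasFDerivAt (by simp [JN.range_eq_univ])
  have hfix : familyInChart J JN a e p (extChartAt JN e e, extChartAt J p p) =
      extChartAt J p p := by
    rw [familyInChart_extChartAt, extChartAt_to_inv, hae]
  have hequiv' : ∀ᶠ s in 𝓝 (extChartAt JN e e),
      fderiv ℝ (familyInChart J JN a e p) (s, extChartAt J p p) (0, X' (extChartAt J p p) w) =
        X' (familyInChart J JN a e p (s, extChartAt J p p)) (A ((extChartAt JN e).symm s) w) := by
    filter_upwards [eventually_fderiv_familyInChart_right ha hae p] with s hs
    rw [familyInChart_extChartAt, hs.2, hX'self, hequiv]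
    exact (fieldInChart_extChartAt (fun q => X q (A ((extChartAt JN e).symm s) w)) hs.1).symm
  have h := lieBracket_eq_neg_of_localAction (contDiffAt_familyInChart ha hae p)
    (eventually_fderiv_familyInChart_left ha hae p ρ) hfix hX' hA' (by simpa using hAe) hequiv'
  exact (mlieBracket_eq_lieBracket_fieldInChart _ _ p).trans
    (h.trans (congrArg Neg.neg (hX'self (A' ρ w))))

end ChartAction

/-! ### Exterior derivatives of one-forms and `d² = 0` -/

section ExteriorDerivative

variable {V : Type*} [NormedAddCommGroup V] [NormedSpace ℝ V]
  {W : Type*} [NormedAddCommGroup W] [NormedSpace ℝ W]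
  {H : Type*} [TopologicalSpace H] {J : ModelWithCorners ℝ V H}
  {M : Type*} [TopologicalSpace M] [ChartedSpace H M]

variable (J) in
/-- The exterior derivative at `p` of a vector-valued one-form, as a bilinear map computed in the
preferred chart at `p`. -/
def extDerivForm (α : (q : M) → TangentSpace J q →L[ℝ] W) (p : M) : V →L[ℝ] V →L[ℝ] W :=
  fderiv ℝ (formInChart J α p) (extChartAt J p p) -
    (fderiv ℝ (formInChart J α p) (extChartAt J p p)).flip

theorem d_neg {n : ℕ} (α : DiffForm J (M := M) n) : (-α).d = -α.d := by
  funext p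
  have h : (-α).inChart p = (-1 : ℝ) • α.inChart p := by
    funext y
    ext v
    exact (neg_one_mul _).symm
  have hd := extDeriv_smul (-1 : ℝ) (α.inChart p) (x := extChartAt J p p)
  rwa [← h, neg_one_smul] at hd

variable [J.Boundaryless]

section

variable [IsManifold J 1 M]

theorem fderiv_formInChart_apply_of_const {α : (q : M) → TangentSpace J q →L[ℝ] W} {p : M}
    (hα : DifferentiableAt ℝ (formInChart J α p) (extChartAt J p p))
    {X : (q : M) → TangentSpace J q}
    (hX : MDifferentiableAt J J.tangent (fun q => (⟨q, X q⟩ : TangentBundle J M)) p)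
    {c : W} (hc : ∀ q, α q (X q) = c) (v : V) :
    fderiv ℝ (formInChart J α p) (extChartAt J p p) v (X p) =
      -α p (fderiv ℝ (fieldInChart J X p) (extChartAt J p p) v) := by
  have hconst : (fun y => formInChart J α p y (fieldInChart J X p y)) =ᶠ[𝓝 (extChartAt J p p)]
      fun _ => c := by
    filter_upwards [extChartAt_target_mem_nhds_self p] with y hy
    rw [formInChart_fieldInChart α X hy, hc]
  have h := DFunLike.congr_fun ((hα.hasFDerivAt.clm_apply
    (differentiableAt_fieldInChart hX).hasFDerivAt).unique
      ((hasFDerivAt_const c _).congr_of_eventuallyEq hconst)) v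
  rw [formInChart_self, fieldInChart_self] at h
  exact eq_neg_of_add_eq_zero_right h

theorem extDerivForm_eq_neg_mlieBracket {α : (q : M) → TangentSpace J q →L[ℝ] W} {p : M}
    (hα : DifferentiableAt ℝ (formInChart J α p) (extChartAt J p p))
    {X Y : (q : M) → TangentSpace J q}
    (hX : MDifferentiableAt J J.tangent (fun q => (⟨q, X q⟩ : TangentBundle J M)) p)
    (hY : MDifferentiableAt J J.tangent (fun q => (⟨q, Y q⟩ : TangentBundle J M)) p)
    {a b : W} (ha : ∀ q, α q (X q) = a) (hb : ∀ q, α q (Y q) = b) :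
    extDerivForm J α p (X p) (Y p) = -α p (mlieBracket J X Y p) := by
  have hbracket := congrArg (α p) (mlieBracket_eq_lieBracket_fieldInChart X Y p)
  rw [lieBracket, fieldInChart_self, fieldInChart_self] at hbracket
  have hsub := congrArg Neg.neg (hbracket.trans (map_sub (α p) _ _))
  refine (congrArg₂ (· - ·) (fderiv_formInChart_apply_of_const hα hY hb (X p))
    (fderiv_formInChart_apply_of_const hα hX ha (Y p))).trans (Eq.trans ?_ hsub.symm)
  abel

theorem inChart_eq_compContinuousLinearMap {n : ℕ} (α : DiffForm J (M := M) n) {p₀ q : M} {z : V}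
    (hz : z ∈ (extChartAt J p₀).target) (hq : (extChartAt J p₀).symm z ∈ (extChartAt J q).source) :
    α.inChart p₀ z =
      (α.inChart q (extChartAt J q ((extChartAt J p₀).symm z))).compContinuousLinearMap
        (fderiv ℝ (fun y => extChartAt J q ((extChartAt J p₀).symm y)) z) := by
  have hφ : MDifferentiableAt J 𝓘(ℝ, V) (extChartAt J q) ((extChartAt J p₀).symm z) :=
    mdifferentiableAt_extChartAt (by rwa [← extChartAt_source J])
  have hchain := mfderiv_comp z hφ (mdifferentiableAt_extChartAt_symm' hz)
  have hderiv (w : V) : mfderiv 𝓘(ℝ, V) J (extChartAt J q).symm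
      (extChartAt J q ((extChartAt J p₀).symm z))
        (fderiv ℝ (fun y => extChartAt J q ((extChartAt J p₀).symm y)) z w) =
      mfderiv 𝓘(ℝ, V) J (extChartAt J p₀).symm z w := by
    rw [← mfderiv_eq_fderiv]
    exact (congrArg _ (DFunLike.congr_fun hchain w)).trans (DFunLike.congr_fun
      (mfderiv_extChartAt_symm_comp_mfderiv_extChartAt hq) _)
  have hbase (x : M) (hx : x = (extChartAt J p₀).symm z) (v : Fin n → V) :
      α ((extChartAt J p₀).symm z) v = α x v := by
    subst hx; rfl
  ext v
  exact (congrArg _ (funext fun i => (hderiv (v i)).symm)).trans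
    (hbase _ ((extChartAt J q).left_inv hq) _)

end

section

variable [IsManifold J ∞ M]

theorem inChart_d_eq_extDeriv {n : ℕ} {α : DiffForm J (M := M) n}
    (hα : ∀ p, ContDiffOn ℝ ∞ (α.inChart p) (extChartAt J p).target) {p₀ : M} {y : V}
    (hy : y ∈ (extChartAt J p₀).target) :
    α.d.inChart p₀ y = extDeriv (α.inChart p₀) y := by
  have : IsManifold J 1 M := IsManifold.of_le (n := ∞) (by simp)
  let q : M := (extChartAt J p₀).symm y
  have htarget := (isOpen_extChartAt_target (I := J) p₀).mem_nhds hy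
  have hsymm := (contMDiffOn_extChartAt_symm (I := J) (n := ∞) p₀).contMDiffAt htarget
  have hpull : α.inChart p₀ =ᶠ[𝓝 y] fun z =>
      (α.inChart q (extChartAt J q ((extChartAt J p₀).symm z))).compContinuousLinearMap
        (fderiv ℝ (fun y => extChartAt J q ((extChartAt J p₀).symm y)) z) := by
    filter_upwards [htarget, hsymm.continuousAt.eventually (extChartAt_source_mem_nhds (I := J) q)]
      with z hz hzq
    exact inChart_eq_compContinuousLinearMap α hz hzq
  have hsmooth : ContDiffAt ℝ ∞ (fun y => extChartAt J q ((extChartAt J p₀).symm y)) y :=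
    (contMDiffAt_extChartAt.comp y hsymm).contDiffAt
  have hdiff : DifferentiableAt ℝ (α.inChart q) (extChartAt J q q) :=
    ((hα q).contDiffAt (extChartAt_target_mem_nhds_self q)).differentiableAt (by simp)
  have hextDeriv := extDeriv_pullback (r := ∞)
    (f := fun z => extChartAt J q ((extChartAt J p₀).symm z)) (x := y) hdiff hsmooth
    (by rw [minSmoothness_of_isRCLikeNormedField]; exact ENat.LEInfty.out)
  have hself : α.d.inChart q (extChartAt J q q) = α.d q := by
    have hbase (x : M) (hx : x = q) :
        (α.d x).compContinuousLinearMap (ContinuousLinearMap.id ℝ V) = α.d q := by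
      subst hx; rfl
    rw [DiffForm.inChart, mfderiv_extChartAt_symm_self]
    exact hbase _ (extChartAt_to_inv q)
  rw [hpull.extDeriv_eq, hextDeriv,
    inChart_eq_compContinuousLinearMap α.d hy (mem_extChartAt_source q), hself]
  rfl

theorem d_d_eq_zero {n : ℕ} {α : DiffForm J (M := M) n}
    (hα : ∀ p, ContDiffOn ℝ ∞ (α.inChart p) (extChartAt J p).target) : α.d.d = 0 := by
  funext p
  have h : α.d.inChart p =ᶠ[𝓝 (extChartAt J p p)] extDeriv (α.inChart p) := by
    filter_upwards [extChartAt_target_mem_nhds_self p] with y hy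
    exact inChart_d_eq_extDeriv hα hy
  exact h.extDeriv_eq.trans (extDeriv_extDeriv_apply (r := ∞)
    ((hα p).contDiffAt (extChartAt_target_mem_nhds_self p))
    (by rw [minSmoothness_of_isRCLikeNormedField]; exact ENat.LEInfty.out))

end

end ExteriorDerivative

/-! ### The adjoint representation -/

section ConstantComposition

variable {S : Type*} [NormedAddCommGroup S] [NormedSpace ℝ S]
  {K : Type*} [TopologicalSpace K] {JN : ModelWithCorners ℝ S K}
  {N : Type*} [TopologicalSpace N] [ChartedSpace K N]
  {W₁ W₂ W₃ : Type*} [NormedAddCommGroup W₁] [NormedSpace ℝ W₁]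
  [NormedAddCommGroup W₂] [NormedSpace ℝ W₂] [NormedAddCommGroup W₃] [NormedSpace ℝ W₃]

theorem add_eq_zero_of_comp_eq_const [JN.Boundaryless] {A : N → W₂ →L[ℝ] W₃} {C : N → W₁ →L[ℝ] W₂}
    {e : N} {A' : S →L[ℝ] W₂ →L[ℝ] W₃} {C' : S →L[ℝ] W₁ →L[ℝ] W₂}
    (hA : HasMFDerivAt JN 𝓘(ℝ, W₂ →L[ℝ] W₃) A e A')
    (hC : HasMFDerivAt JN 𝓘(ℝ, W₁ →L[ℝ] W₂) C e C')
    {D : W₁ →L[ℝ] W₃} (hD : ∀ s, (A s).comp (C s) = D) (ρ : S) (w : W₁) :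
    A' ρ (C e w) + A e (C' ρ w) = 0 := by
  have hA' : HasFDerivAt (fun s => A ((extChartAt JN e).symm s)) A' (extChartAt JN e e) :=
    hA.2.hasFDerivAt (by simp [JN.range_eq_univ])
  have hC' : HasFDerivAt (fun s => C ((extChartAt JN e).symm s)) C' (extChartAt JN e e) :=
    hC.2.hasFDerivAt (by simp [JN.range_eq_univ])
  have hcomp := hA'.clm_comp hC'
  simp only [hD, extChartAt_to_inv] at hcomp
  have h := DFunLike.congr_fun (DFunLike.congr_fun (hcomp.unique (hasFDerivAt_const D _)) ρ) w
  exact (add_comm _ _).trans h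

end ConstantComposition

section AdjointRepresentation

variable {E : Type*} [NormedAddCommGroup E] [NormedSpace ℝ E]
  {G : Type*} [TopologicalSpace G] [ChartedSpace E G] [Group G]

theorem Ad_one : (Ad (1 : G) : E →L[ℝ] E) = ContinuousLinearMap.id ℝ E := by
  have h : (fun h : G => 1 * h * 1⁻¹) = id := by
    ext h
    simp
  rw [Ad, h]
  exact mfderiv_id

variable (E G) in
/-- The infinitesimal adjoint representation `𝔤 → End 𝔤`: the differential of `Ad` at `1`. -/
def infinitesimalAd : E →L[ℝ] E →L[ℝ] E :=
  mfderiv 𝓘(ℝ, E) 𝓘(ℝ, E →L[ℝ] E) (Ad : G → E →L[ℝ] E) 1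

variable [LieGroup 𝓘(ℝ, E) ∞ G]

theorem contMDiff_conj :
    ContMDiff (𝓘(ℝ, E).prod 𝓘(ℝ, E)) 𝓘(ℝ, E) ∞ (fun x : G × G => x.1 * x.2 * x.1⁻¹) :=
  (contMDiff_fst.mul contMDiff_snd).mul contMDiff_fst.inv

theorem mdifferentiableAt_conj (g h : G) :
    MDifferentiableAt 𝓘(ℝ, E) 𝓘(ℝ, E) (fun h : G => g * h * g⁻¹) h :=
  (contMDiff_conj.comp (contMDiff_const.prodMk contMDiff_id)).mdifferentiable (by simp) h

theorem contMDiff_Ad : ContMDiff 𝓘(ℝ, E) 𝓘(ℝ, E →L[ℝ] E) ∞ (Ad : G → E →L[ℝ] E) := fun g₀ => by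
  have : IsManifold 𝓘(ℝ, E) 1 G := IsManifold.of_le (n := ∞) (by simp)
  have hcoordChange (x y : G) (hx : x = 1) (hy : y = 1) (v : E) :
      (tangentBundleCore 𝓘(ℝ, E) G).coordChange (achart E x) (achart E y) x v = v := by
    subst hx hy
    exact (tangentBundleCore 𝓘(ℝ, E) G).coordChange_self _ _ (mem_chart_source E 1) v
  have h := ContMDiffAt.mfderiv (m := ∞) (n := ∞) (I := 𝓘(ℝ, E)) (I' := 𝓘(ℝ, E)) (J := 𝓘(ℝ, E))
    (fun g h : G => g * h * g⁻¹) (fun _ => (1 : G)) (x₀ := g₀)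
    contMDiff_conj.contMDiffAt contMDiffAt_const (by simp)
  refine h.congr_of_eventuallyEq (Eventually.of_forall fun g => ?_)
  have hcoord := inTangentCoordinates_eq (I := 𝓘(ℝ, E)) (I' := 𝓘(ℝ, E)) (fun _ : G => (1 : G))
    (fun k : G => k * 1 * k⁻¹) (fun k => Ad k) (x₀ := g₀) (x := g) (mem_chart_source E _) (by simp)
  refine Eq.trans ?_ hcoord.symm
  ext v
  exact ((hcoordChange _ _ (by simp) (by simp) _).trans
    (congrArg (Ad (E := E) g) (hcoordChange 1 1 rfl rfl v))).symm

theorem Ad_mul (g h : G) : (Ad (g * h) : E →L[ℝ] E) = (Ad g).comp (Ad h) := by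
  have hconj : (fun k : G => g * h * k * (g * h)⁻¹) =
      (fun k => g * k * g⁻¹) ∘ fun k => h * k * h⁻¹ := by
    ext k
    simp [mul_assoc]
  ext v
  rw [Ad, hconj]
  exact mfderiv_comp_apply_of_eq (I := 𝓘(ℝ, E)) (I' := 𝓘(ℝ, E)) (I'' := 𝓘(ℝ, E)) _
    (mdifferentiableAt_conj g 1) (mdifferentiableAt_conj h 1) (by simp) v

theorem Ad_inv_apply_Ad_apply (g : G) (x : E) : Ad g⁻¹ (Ad g x) = x := by
  rw [← ContinuousLinearMap.comp_apply, ← Ad_mul (E := E), inv_mul_cancel, Ad_one]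
  rfl

theorem hasMFDerivAt_Ad_one :
    HasMFDerivAt 𝓘(ℝ, E) 𝓘(ℝ, E →L[ℝ] E) (Ad : G → E →L[ℝ] E) 1 (infinitesimalAd E G) :=
  (contMDiff_Ad.mdifferentiable (by simp) 1).hasMFDerivAt

theorem mfderiv_mul_right_mulInvariantVectorField (g h : G) (w : E) :
    mfderiv 𝓘(ℝ, E) 𝓘(ℝ, E) (· * g) h (mulInvariantVectorField (I := 𝓘(ℝ, E)) w h) =
      mulInvariantVectorField (I := 𝓘(ℝ, E)) (Ad (E := E) g⁻¹ w) (h * g) := by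
  have hleft (k l : G) : MDifferentiableAt 𝓘(ℝ, E) 𝓘(ℝ, E) (fun x => k * x) l :=
    (contMDiff_mul_left (I := 𝓘(ℝ, E)) (n := ∞)).mdifferentiable (by simp) l
  have hright : MDifferentiableAt 𝓘(ℝ, E) 𝓘(ℝ, E) (fun x => x * g) h :=
    (contMDiff_mul_right (I := 𝓘(ℝ, E)) (n := ∞)).mdifferentiable (by simp) h
  have hcomp : (fun x : G => x * g) ∘ (fun x => h * x) =
      (fun x => h * g * x) ∘ (fun x => g⁻¹ * x * g⁻¹⁻¹) := by
    ext x
    simp [mul_assoc]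
  refine (mfderiv_comp_apply_of_eq (I := 𝓘(ℝ, E)) (I' := 𝓘(ℝ, E)) (I'' := 𝓘(ℝ, E)) 1 hright
    (hleft h 1) (mul_one h) w).symm.trans ?_
  rw [hcomp]
  exact mfderiv_comp_apply_of_eq (I := 𝓘(ℝ, E)) (I' := 𝓘(ℝ, E)) (I'' := 𝓘(ℝ, E)) 1
    (hleft (h * g) 1) (mdifferentiableAt_conj g⁻¹ 1) (by simp) w

theorem infinitesimalAd_apply [FiniteDimensional ℝ E] (x y : E) :
    infinitesimalAd E G x y = lieBr G x y := by
  have := lieGroup_minSmoothness (E := E) G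
  have hmul : ContMDiff (𝓘(ℝ, E).prod 𝓘(ℝ, E)) 𝓘(ℝ, E) ∞ (fun x : G × G => x.2 * x.1) :=
    contMDiff_snd.mul contMDiff_fst
  have hAd_inv : ContMDiff 𝓘(ℝ, E) 𝓘(ℝ, E →L[ℝ] E) ∞ (fun g : G => (Ad g⁻¹ : E →L[ℝ] E)) :=
    contMDiff_Ad.comp (contMDiff_inv 𝓘(ℝ, E) ∞)
  obtain ⟨B, hB⟩ : ∃ B : E →L[ℝ] E →L[ℝ] E,
      HasMFDerivAt 𝓘(ℝ, E) 𝓘(ℝ, E →L[ℝ] E) (fun g : G => (Ad g⁻¹ : E →L[ℝ] E)) 1 B :=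
    ⟨_, (hAd_inv.mdifferentiable (by simp) 1).hasMFDerivAt⟩
  have hbracket : lieBr G x y = -(mfderiv 𝓘(ℝ, E) 𝓘(ℝ, E) (fun h : G => 1 * h) 1 : E →L[ℝ] E)
      (B x y) :=
    mlieBracket_eq_neg_of_equivariant (J := 𝓘(ℝ, E)) (JN := 𝓘(ℝ, E)) (W := E)
      (a := fun g h : G => h * g) (e := 1) (p := 1)
      (X := fun h => (mfderiv 𝓘(ℝ, E) 𝓘(ℝ, E) (h * ·) 1 : E →L[ℝ] E)) hmul mul_one
      (fun w => mdifferentiableAt_mulInvariantVectorField (I := 𝓘(ℝ, E)) (G := G) w)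
      hB (by rw [inv_one, Ad_one])
      (fun g w => mfderiv_mul_right_mulInvariantVectorField g 1 w) x y
  have hone : (fun h : G => 1 * h) = id := funext one_mul
  have hconst := add_eq_zero_of_comp_eq_const hB hasMFDerivAt_Ad_one
    (D := ContinuousLinearMap.id ℝ E) (fun g => by ext v; simp [Ad_inv_apply_Ad_apply]) x y
  rw [Ad_one, inv_one, Ad_one] at hconst
  rw [hbracket, hone, mfderiv_id]
  exact eq_neg_of_add_eq_zero_right hconst

end AdjointRepresentation

/-! ### The frame dual to a connection and a horizontal form -/

section Framing

variable {E : Type*} [NormedAddCommGroup E] [NormedSpace ℝ E]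
  {G : Type*} [TopologicalSpace G] [ChartedSpace E G] [Group G] [LieGroup 𝓘(ℝ, E) ∞ G]

theorem contMDiff_act :
    ContMDiff (𝓘(ℝ, E).prod (IP E)) (IP E) ∞ (fun x : G × (G × E) => act x.1 x.2) :=
  (contMDiff_fst.mul (contMDiff_fst.comp contMDiff_snd)).prodMk
    (contMDiff_snd.comp contMDiff_snd)

variable [FiniteDimensional ℝ E]

theorem lieBr_zero (x : E) : lieBr G x (0 : E) = 0 := by
  rw [← infinitesimalAd_apply, map_zero]

theorem lieBr_swap (x y : E) : lieBr G x y = -lieBr G y x := by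
  have := lieGroup_minSmoothness (E := E) G
  exact (lie_skew (L := GroupLieAlgebra 𝓘(ℝ, E) G) x y).symm

/-- The frame of `TP` dual to `(θ, L)`: at `p` it sends `(ρ, σ)` to the vector `X` with `θ X = ρ`
and `L X = σ`, that is, to `ρ* + I σ*`. -/
def frame (θ L : (p : G × E) → TP p →L[ℝ] E) (p : G × E) : E × E →L[ℝ] TP p :=
  ((θ p).prod (L p)).inverse

variable {θ L : (p : G × E) → TP p →L[ℝ] E}

theorem isInvertible_prod (hθ : IsConnectionForm θ) (hL : IsNondegHorizontalForm L) (p : G × E) :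
    ((θ p).prod (L p)).IsInvertible := by
  let F : E × E →L[ℝ] E × E := (θ p).prod (L p)
  have hinj : Function.Injective F.toLinearMap := by
    rw [← LinearMap.ker_eq_bot, LinearMap.ker_eq_bot']
    intro X hX
    obtain ⟨hθX, hLX⟩ : θ p X = 0 ∧ L p X = 0 := Prod.ext_iff.1 hX
    obtain ⟨ρ, hρ⟩ := hL.nondegenerate p X hLX
    have hρ0 : ρ = 0 := (hθ.fund ρ p).symm.trans ((congrArg (θ p) hρ.symm).trans hθX)
    exact hρ.trans ((congrArg (fund · p) hρ0).trans (map_zero (M := E) _))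
  exact ⟨(LinearEquiv.ofInjectiveEndo _ hinj).toContinuousLinearEquiv, by ext x <;> rfl⟩

theorem prod_frame (hθ : IsConnectionForm θ) (hL : IsNondegHorizontalForm L) (p : G × E)
    (z : E × E) : (θ p (frame θ L p z), L p (frame θ L p z)) = z :=
  (isInvertible_prod hθ hL p).self_apply_inverse z

theorem IsConnectionForm.apply_frame (hθ : IsConnectionForm θ) (hL : IsNondegHorizontalForm L)
    (p : G × E) (z : E × E) : θ p (frame θ L p z) = z.1 :=
  congrArg Prod.fst (prod_frame hθ hL p z)

theorem IsNondegHorizontalForm.apply_frame (hL : IsNondegHorizontalForm L) (hθ : IsConnectionForm θ)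
    (p : G × E) (z : E × E) : L p (frame θ L p z) = z.2 :=
  congrArg Prod.snd (prod_frame hθ hL p z)

theorem frame_prod (hθ : IsConnectionForm θ) (hL : IsNondegHorizontalForm L) (p : G × E)
    (X : TP p) : frame θ L p (θ p X, L p X) = X :=
  (isInvertible_prod hθ hL p).inverse_apply_self X

theorem frame_inl (hθ : IsConnectionForm θ) (hL : IsNondegHorizontalForm L) (ρ : E) (p : G × E) :
    frame θ L p (ρ, 0) = fund ρ p := by
  have h := frame_prod hθ hL p (fund ρ p)
  rwa [hθ.fund, hL.horizontal] at h

theorem IsConnectionForm.apply_cplx (hθ : IsConnectionForm θ) (hL : IsNondegHorizontalForm L)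
    (p : G × E) (X : TP p) : θ p (cplx θ L p X) = -L p X :=
  hθ.apply_frame hL p _

theorem IsNondegHorizontalForm.apply_cplx (hL : IsNondegHorizontalForm L) (hθ : IsConnectionForm θ)
    (p : G × E) (X : TP p) : L p (cplx θ L p X) = θ p X :=
  hL.apply_frame hθ p _

theorem cplx_frame (hθ : IsConnectionForm θ) (hL : IsNondegHorizontalForm L) (p : G × E)
    (z : E × E) : cplx θ L p (frame θ L p z) = frame θ L p (-z.2, z.1) :=
  congrArg (frame θ L p) <|
    Prod.ext (congrArg Neg.neg (hL.apply_frame hθ p z)) (hθ.apply_frame hL p z)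

theorem dAct_frame (hθ : IsConnectionForm θ) (hL : IsNondegHorizontalForm L) (g : G) (p : G × E)
    (z : E × E) : dAct g p (frame θ L p z) = frame θ L (act g p) (Ad g z.1, Ad g z.2) := by
  have h := frame_prod hθ hL (act g p) (dAct g p (frame θ L p z))
  rw [hθ.equivariant, hL.equivariant, hθ.apply_frame hL, hL.apply_frame hθ] at h
  exact h.symm

theorem contMDiff_frame (hθ : IsConnectionForm θ) (hL : IsNondegHorizontalForm L) (z : E × E) :
    ContMDiff (IP E) (IP E).tangent ∞
      (fun p => (⟨p, frame θ L p z⟩ : TangentBundle (IP E) (G × E))) :=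
  contMDiff_inverse_apply (α := fun p => (θ p).prod (L p))
    (hθ.smooth.prodMk_space hL.smooth) (isInvertible_prod hθ hL) z

theorem mdifferentiableAt_frame (hθ : IsConnectionForm θ) (hL : IsNondegHorizontalForm L)
    (z : E × E) (p : G × E) :
    MDifferentiableAt (IP E) (IP E).tangent
      (fun p => (⟨p, frame θ L p z⟩ : TangentBundle (IP E) (G × E))) p :=
  (contMDiff_frame hθ hL z).mdifferentiable (by simp) p

theorem mlieBracket_frame_inl (hθ : IsConnectionForm θ) (hL : IsNondegHorizontalForm L)
    (ρ : E) (z : E × E) (p : G × E) :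
    mlieBracket (IP E) (fun q => frame θ L q (ρ, 0)) (fun q => frame θ L q z) p =
      -frame θ L p (lieBr G ρ z.1, lieBr G ρ z.2) := by
  simp only [frame_inl hθ hL]
  have hAd := hasMFDerivAt_Ad_one (E := E) (G := G)
  have hAdAd : HasMFDerivAt 𝓘(ℝ, E) 𝓘(ℝ, (E →L[ℝ] E) × (E →L[ℝ] E))
      (fun g : G => ((Ad g, Ad g) : (E →L[ℝ] E) × (E →L[ℝ] E))) 1
      ((infinitesimalAd E G).prod (infinitesimalAd E G)) :=
    ⟨hAd.1.prodMk hAd.1, hAd.2.prodMk hAd.2⟩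
  have h := mlieBracket_eq_neg_of_equivariant (J := IP E) (JN := 𝓘(ℝ, E)) (W := E × E)
    (a := act) (e := (1 : G)) (p := p) (X := frame θ L) contMDiff_act
    (fun q => Prod.ext (one_mul q.1) rfl)
    (fun w => mdifferentiableAt_frame hθ hL w p)
    ((ContinuousLinearMap.prodMapL ℝ E E E E).hasMFDerivAt.comp 1 hAdAd)
    (by ext w <;> simp [Ad_one])
    (fun s w => dAct_frame hθ hL s p w) ρ z
  refine h.trans (congrArg (fun w => -frame θ L p w) ?_)
  exact Prod.ext (infinitesimalAd_apply _ _) (infinitesimalAd_apply _ _)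

theorem mlieBracket_frame_inr_inl (hθ : IsConnectionForm θ) (hL : IsNondegHorizontalForm L)
    (a b : E) (p : G × E) :
    mlieBracket (IP E) (fun q => frame θ L q (0, a)) (fun q => frame θ L q (b, 0)) p =
      -frame θ L p (0, lieBr G a b) := by
  rw [mlieBracket_swap_apply, mlieBracket_frame_inl hθ hL, lieBr_zero, lieBr_swap b a,
    ← map_neg, Prod.neg_mk, neg_zero, neg_neg]

theorem mlieBracket_frame_inr_inr (hθ : IsConnectionForm θ) (hL : IsNondegHorizontalForm L)
    (hI : IsIntegrable (IP E) (M := G × E) (cplx θ L)) (a b : E) (p : G × E) :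
    mlieBracket (IP E) (fun q => frame θ L q (0, a)) (fun q => frame θ L q (0, b)) p =
      frame θ L p (lieBr G a b, 0) := by
  have hN := hI (fun q => frame θ L q (a, 0)) (fun q => frame θ L q (b, 0))
    (contMDiff_frame hθ hL _) (contMDiff_frame hθ hL _) p
  simp only [cplx_frame hθ hL, neg_zero] at hN
  rw [mlieBracket_frame_inr_inl hθ hL, mlieBracket_frame_inl hθ hL, mlieBracket_frame_inl hθ hL,
    lieBr_zero, map_neg, cplx_frame hθ hL, ← map_neg, Prod.neg_mk, neg_neg, neg_zero,
    sub_neg_eq_add] at hN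
  exact sub_eq_zero.1 ((sub_add_cancel _ _).symm.trans hN)

theorem mlieBracket_frame (hθ : IsConnectionForm θ) (hL : IsNondegHorizontalForm L)
    (hI : IsIntegrable (IP E) (M := G × E) (cplx θ L)) (x y : E × E) (p : G × E) :
    mlieBracket (IP E) (fun q => frame θ L q x) (fun q => frame θ L q y) p =
      -frame θ L p
        (lieBr G x.1 y.1 - lieBr G x.2 y.2, lieBr G x.1 y.2 + lieBr G x.2 y.1) := by
  have hsplit (z : E × E) : (fun q => frame θ L q z) =
      (fun q => frame θ L q (z.1, 0)) + fun q => frame θ L q (0, z.2) := by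
    funext q
    change _ = frame θ L q (z.1, 0) + frame θ L q (0, z.2)
    rw [← map_add, Prod.fst_add_snd]
  have hdiff (z : E × E) := mdifferentiableAt_frame hθ hL z p
  rw [hsplit x, mlieBracket_add_left (hdiff _) (hdiff _), mlieBracket_frame_inl hθ hL, hsplit y,
    mlieBracket_add_right (hdiff _) (hdiff _), mlieBracket_frame_inr_inl hθ hL,
    mlieBracket_frame_inr_inr hθ hL hI,
    ← map_neg, ← map_neg, ← map_neg, ← map_add, ← map_add]
  congr 1
  ext <;> simp <;> abel

theorem extDerivForm_connection (hθ : IsConnectionForm θ) (hL : IsNondegHorizontalForm L)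
    (hI : IsIntegrable (IP E) (M := G × E) (cplx θ L)) (p : G × E) (X Y : TP p) :
    extDerivForm (IP E) θ p X Y = lieBr G (θ p X) (θ p Y) - lieBr G (L p X) (L p Y) := by
  have hdiff : DifferentiableAt ℝ (formInChart (IP E) θ p) (extChartAt (IP E) p p) :=
    (contDiffAt_formInChart hθ.smooth p).differentiableAt (by simp)
  have h := extDerivForm_eq_neg_mlieBracket hdiff
    (mdifferentiableAt_frame hθ hL (θ p X, L p X) p)
    (mdifferentiableAt_frame hθ hL (θ p Y, L p Y) p)
    (fun q => hθ.apply_frame hL q _) (fun q => hθ.apply_frame hL q _)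
  rw [mlieBracket_frame hθ hL hI, map_neg, neg_neg, hθ.apply_frame hL] at h
  simpa only [frame_prod hθ hL] using h

end Framing

/-! ### Smooth positive definite bilinear forms -/

section SmoothBilinearForms

variable {V : Type*} [NormedAddCommGroup V] [NormedSpace ℝ V]
  {W : Type*} [NormedAddCommGroup W] [NormedSpace ℝ W]
  {F : Type*} [NormedAddCommGroup F] [NormedSpace ℝ F]
  {H : Type*} [TopologicalSpace H] {J : ModelWithCorners ℝ V H}
  {M : Type*} [TopologicalSpace M] [ChartedSpace H M]

theorem contMDiffAt_of_forall_apply [FiniteDimensional ℝ W] {B : M → W →L[ℝ] F} {p : M}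
    (hB : ∀ w, ContMDiffAt J 𝓘(ℝ, F) ∞ (fun q => B q w) p) :
    ContMDiffAt J 𝓘(ℝ, W →L[ℝ] F) ∞ B p := by
  have hdim : Module.finrank ℝ W = Module.finrank ℝ (Fin (Module.finrank ℝ W) → ℝ) := by simp
  let coords := ContinuousLinearEquiv.ofFinrankEq hdim
  let e := (coords.arrowCongr (1 : F ≃L[ℝ] F)).trans
    (ContinuousLinearEquiv.piRing (Fin (Module.finrank ℝ W)))
  have h := e.symm.contDiff.contMDiff.contMDiffAt.comp p
    (contMDiffAt_pi_space.2 fun i => hB (coords.symm (Pi.single i 1)))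
  refine h.congr_of_eventuallyEq (Eventually.of_forall fun q => ?_)
  exact (e.symm_apply_apply (B q)).symm

variable [IsManifold J ∞ M]

theorem contMDiff_mfderiv_apply {f : M → W} (hf : ContMDiff J 𝓘(ℝ, W) ∞ f) :
    ContMDiff J.tangent 𝓘(ℝ, W) ∞
      (fun v : TangentBundle J M => (mfderiv J 𝓘(ℝ, W) f v.1 v.2 : W)) :=
  (contMDiff_snd_tangentBundle_modelSpace W 𝓘(ℝ, W)).comp
    (hf.contMDiff_tangentMap (m := ∞) (by simp))

variable [J.Boundaryless]

theorem formInChart_extChartAt_apply (α : (p : M) → TangentSpace J p →L[ℝ] W) {p q : M}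
    (hq : q ∈ (chartAt H p).source) (v : V) : formInChart J α p (extChartAt J p q) v =
      α q ((trivializationAt V (TangentSpace J) p).symm q v) := by
  have : IsManifold J 1 M := IsManifold.of_le (n := ∞) (by simp)
  have h := TangentBundle.symmL_trivializationAt (I := J) hq
  rw [J.range_eq_univ, mfderivWithin_univ] at h
  have hsymm := (Bundle.Trivialization.symmL_apply (R := ℝ) _ (by simpa using hq) _).symm.trans
    (DFunLike.congr_fun h v)
  have hbase (q' : M) (hq' : q' = q) (w : V) : α q' w = α q w := by subst hq'; rfl
  exact (hbase _ ((extChartAt J p).left_inv (by rwa [extChartAt_source])) _).trans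
    (congrArg (α q) hsymm.symm)

theorem contMDiff_bilinear_of_apply_eq [FiniteDimensional ℝ V]
    {b : (p : M) → TangentSpace J p →L[ℝ] TangentSpace J p →L[ℝ] ℝ}
    {B : M → W →L[ℝ] W →L[ℝ] ℝ} {α : (p : M) → TangentSpace J p →L[ℝ] W}
    (hB : ContMDiff J 𝓘(ℝ, W →L[ℝ] W →L[ℝ] ℝ) ∞ B)
    (hα : ContMDiff J.tangent 𝓘(ℝ, W) ∞ (fun v : TangentBundle J M => α v.1 v.2))
    (hb : ∀ p X Y, b p X Y = B p (α p X) (α p Y)) :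
    ContMDiff J (J.prod 𝓘(ℝ, V →L[ℝ] V →L[ℝ] ℝ)) ∞
      (fun p : M => Bundle.TotalSpace.mk' (V →L[ℝ] V →L[ℝ] ℝ)
        (E := fun p : M => TangentSpace J p →L[ℝ] TangentSpace J p →L[ℝ] ℝ) p (b p)) := by
  have : IsManifold J 1 M := IsManifold.of_le (n := ∞) (by simp)
  intro p
  rw [contMDiffAt_hom_bundle]
  refine ⟨contMDiffAt_id, contMDiffAt_of_forall_apply fun v =>
    contMDiffAt_of_forall_apply fun w => ?_⟩
  have hαp (v : V) := ((contDiffAt_formInChart hα p).clm_apply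
    (contDiffAt_const (c := v))).contMDiffAt.comp p contMDiffAt_extChartAt
  refine (((hB p).clm_apply (hαp v)).clm_apply (hαp w)).congr_of_eventuallyEq ?_
  filter_upwards [extChartAt_source_mem_nhds (I := J) p] with q hq
  have hq' : q ∈ (chartAt H p).source := by rwa [← extChartAt_source J]
  have hbase : q ∈ (trivializationAt V (TangentSpace J) p).baseSet := by simpa using hq'
  refine (inCoordinates_apply_eq₂ (F₃ := ℝ) (E₃ := Bundle.Trivial M ℝ)
    (ϕ := b q) (v := v) (w := w) hbase hbase (Set.mem_univ _)).trans ?_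
  simp only [Bundle.Trivial.fiberBundle_trivializationAt',
    Bundle.Trivial.linearMapAt_trivialization, LinearMap.id_coe, id_eq]
  exact (hb q _ _).trans (congrArg₂ (fun x y => B q x y)
    (formInChart_extChartAt_apply α hq' v).symm (formInChart_extChartAt_apply α hq' w).symm)

theorem contMDiff_bilinear_of_inverse_apply [FiniteDimensional ℝ V]
    [FiniteDimensional ℝ W] {b : (p : M) → TangentSpace J p →L[ℝ] TangentSpace J p →L[ℝ] ℝ}
    {α : (p : M) → TangentSpace J p →L[ℝ] W}
    (hα : ContMDiff J.tangent 𝓘(ℝ, W) ∞ (fun v : TangentBundle J M => α v.1 v.2))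
    (hinv : ∀ p, (α p).IsInvertible)
    (hb : ∀ z w, ContMDiff J 𝓘(ℝ, ℝ) ∞ (fun p => b p ((α p).inverse z) ((α p).inverse w))) :
    ContMDiff J (J.prod 𝓘(ℝ, V →L[ℝ] V →L[ℝ] ℝ)) ∞
      (fun p : M => Bundle.TotalSpace.mk' (V →L[ℝ] V →L[ℝ] ℝ)
        (E := fun p : M => TangentSpace J p →L[ℝ] TangentSpace J p →L[ℝ] ℝ) p (b p)) :=
  contMDiff_bilinear_of_apply_eq
    (B := fun p => ContinuousLinearMap.bilinearComp (E := V) (F := V) (b p) (α p).inverse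
      (α p).inverse)
    (fun p => contMDiffAt_of_forall_apply fun z => contMDiffAt_of_forall_apply fun w => hb z w p)
    hα
    fun p X Y => (congrArg₂ (fun X Y => b p X Y) ((hinv p).inverse_apply_self X)
      ((hinv p).inverse_apply_self Y)).symm

end SmoothBilinearForms

section PositiveDefinite

variable {V : Type*} [NormedAddCommGroup V] [NormedSpace ℝ V] {b : V →L[ℝ] V →L[ℝ] ℝ}

theorem isCoercive_of_posDef [FiniteDimensional ℝ V] (hb : ∀ v, v ≠ 0 → 0 < b v v) :
    IsCoercive b := by
  have : ProperSpace V := FiniteDimensional.proper_real V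
  rcases subsingleton_or_nontrivial V with _ | _
  · exact ⟨1, one_pos, fun v => by simp [Subsingleton.elim v 0]⟩
  have hcont : Continuous fun v => b v v := b.continuous.clm_apply continuous_id
  obtain ⟨u, hu, hmin⟩ := (isCompact_sphere (0 : V) 1).exists_isMinOn
    (NormedSpace.sphere_nonempty.2 zero_le_one) hcont.continuousOn
  refine ⟨b u u, hb u (ne_zero_of_mem_unit_sphere ⟨u, hu⟩), fun v => ?_⟩
  rcases eq_or_ne v 0 with rfl | hv
  · simp
  have hv' : 0 < ‖v‖ := norm_pos_iff.2 hv
  have hunit : b u u ≤ b (‖v‖⁻¹ • v) (‖v‖⁻¹ • v) := hmin (by simp [norm_smul, hv'.ne'])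
  calc b u u * ‖v‖ * ‖v‖ ≤ b (‖v‖⁻¹ • v) (‖v‖⁻¹ • v) * ‖v‖ * ‖v‖ := by gcongr
    _ = b v v := by
      simp only [map_smul, smul_apply, smul_eq_mul]
      field_simp

theorem isVonNBounded_of_isCoercive (hb : IsCoercive b) :
    Bornology.IsVonNBounded ℝ {v : V | b v v < 1} := by
  obtain ⟨c, hc, hle⟩ := hb
  refine (NormedSpace.isVonNBounded_iff' ℝ).2 ⟨√c⁻¹, fun v hv => Real.le_sqrt_of_sq_le ?_⟩
  rw [← one_div, le_div_iff₀' hc, sq, ← mul_assoc]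
  exact (hle v).trans (le_of_lt hv)

end PositiveDefinite

/-! ### The covariant derivative of an equivariant map -/

theorem extDeriv_oneForm_apply {𝕜 V F : Type*} [NontriviallyNormedField 𝕜]
    [NormedAddCommGroup V] [NormedSpace 𝕜 V] [NormedAddCommGroup F] [NormedSpace 𝕜 F]
    {α : V → V [⋀^Fin 1]→L[𝕜] F} {y : V} (hα : DifferentiableAt 𝕜 α y) (v w : V) :
    extDeriv α y ![v, w] = fderiv 𝕜 (fun z => α z ![w]) y v - fderiv 𝕜 (fun z => α z ![v]) y w := by
  have hremove₀ : (0 : Fin 2).removeNth ![v, w] = ![w] := by ext i; fin_cases i; rfl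
  have hremove₁ : (1 : Fin 2).removeNth ![v, w] = ![v] := by ext i; fin_cases i; rfl
  rw [extDeriv_apply hα, Fin.sum_univ_two, hremove₀, hremove₁]
  simp [sub_eq_add_neg]

section MomentMap

variable {E : Type*} [NormedAddCommGroup E] [NormedSpace ℝ E]
  {G : Type*} [TopologicalSpace G] [ChartedSpace E G] [Group G]
  {μ : G × E → (E →L[ℝ] ℝ)}

theorem IsSmoothEquivariant.mdifferentiableAt (hμ : IsSmoothEquivariant μ) (p : G × E) :
    MDifferentiableAt (IP E) 𝓘(ℝ, E →L[ℝ] ℝ) μ p :=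
  hμ.smooth.mdifferentiable (by simp) p

variable [LieGroup 𝓘(ℝ, E) ∞ G]

theorem dMap_dAct (hμ : IsSmoothEquivariant μ) (g : G) (p : G × E) (X : TP p) :
    dMap μ (act g p) (dAct g p X) = coAd g (dMap μ p X) := by
  let C : (E →L[ℝ] ℝ) →L[ℝ] (E →L[ℝ] ℝ) := (ContinuousLinearMap.compL ℝ E E ℝ).flip (Ad g⁻¹)
  have hact : MDifferentiableAt (IP E) (IP E) (act g : G × E → G × E) p :=
    (contMDiff_act.comp (contMDiff_const.prodMk contMDiff_id)).mdifferentiable (by simp) p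
  have hleft := mfderiv_comp_apply p (hμ.mdifferentiableAt (act g p)) hact X
  have hright := (C.hasMFDerivAt (x := μ p)).comp p (hμ.mdifferentiableAt p).hasMFDerivAt
  have hequiv : μ ∘ act g = C ∘ μ := funext fun q => hμ.equivariant g q
  rw [hequiv] at hleft
  exact hleft.symm.trans (DFunLike.congr_fun hright.mfderiv X)

theorem dMap_fund (hμ : IsSmoothEquivariant μ) [FiniteDimensional ℝ E] (ρ : E) (p : G × E) :
    dMap μ p (fund ρ p) = -ad G (μ p) ρ := by
  have hfund : MDifferentiableAt 𝓘(ℝ, E) (IP E) (fun g : G => act g p) 1 :=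
    (contMDiff_act.comp (contMDiff_id.prodMk contMDiff_const)).mdifferentiable (by simp) 1
  have hact : act (1 : G) p = p := Prod.ext (one_mul p.1) rfl
  have hμp : MDifferentiableAt (IP E) 𝓘(ℝ, E →L[ℝ] ℝ) μ p := hμ.mdifferentiableAt p
  have hcomp_at (q : G × E) (hq : q = p) : HasMFDerivAt (IP E) 𝓘(ℝ, E →L[ℝ] ℝ) μ q (dMap μ p) := by
    subst hq; exact hμp.hasMFDerivAt
  have hcomp : HasMFDerivAt 𝓘(ℝ, E) 𝓘(ℝ, E →L[ℝ] ℝ) (fun g : G => μ (act g p)) 1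
      ((dMap μ p).comp (mfderiv 𝓘(ℝ, E) (IP E) (fun g : G => act g p) 1 : E →L[ℝ] E × E)) :=
    (hcomp_at _ hact).comp 1 hfund.hasMFDerivAt
  have hequiv (g : G) : (μ (act g p)).comp (Ad g) = μ p := by
    ext y
    rw [hμ.equivariant]
    exact congrArg (μ p) (Ad_inv_apply_Ad_apply g y)
  ext y
  have h := add_eq_zero_of_comp_eq_const hcomp hasMFDerivAt_Ad_one hequiv ρ y
  rw [hact, Ad_one, infinitesimalAd_apply] at h
  exact eq_neg_of_add_eq_zero_left h

variable [FiniteDimensional ℝ E] {θ : (p : G × E) → TP p →L[ℝ] E}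

theorem ad_swap (ξ : E →L[ℝ] ℝ) (x y : E) : ad G ξ x y = -ad G ξ y x :=
  (congrArg ξ (lieBr_swap x y)).trans (map_neg ξ _)

theorem covDeriv_apply (p : G × E) (X : TP p) :
    covDeriv θ μ p X = dMap μ p X + ad G (μ p) (θ p X) :=
  rfl

theorem covDeriv_fund (hθ : IsConnectionForm θ) (hμ : IsSmoothEquivariant μ) (ρ : E) (p : G × E) :
    covDeriv θ μ p (fund ρ p) = 0 := by
  rw [covDeriv_apply, dMap_fund hμ, hθ.fund, neg_add_cancel]

theorem contDiffOn_pairing_inChart (hθ : IsConnectionForm θ) (hμ : IsSmoothEquivariant μ)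
    (p : G × E) : ContDiffOn ℝ ∞ ((pairing μ θ).inChart p) (extChartAt (IP E) p).target := by
  have hμchart := contMDiffOn_iff_contDiffOn.1
    (hμ.smooth.comp_contMDiffOn (contMDiffOn_extChartAt_symm p))
  exact (hμchart.clm_comp (contDiffOn_formInChart hθ.smooth p)).continuousLinearMap_comp
    (ContinuousAlternatingMap.ofSubsingletonLIE (𝕜 := ℝ) (E := E × E) (F := ℝ)
      (0 : Fin 1)).toContinuousLinearEquiv.toContinuousLinearMap

theorem d_pairing_apply (hθ : IsConnectionForm θ) (hμ : IsSmoothEquivariant μ) (p : G × E)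
    (X Y : TP p) : (pairing μ θ).d p ![X, Y] =
      dMap μ p X (θ p Y) - dMap μ p Y (θ p X) + μ p (extDerivForm (IP E) θ p X Y) := by
  let y := extChartAt (IP E) p p
  have hpairing : DifferentiableAt ℝ ((pairing μ θ).inChart p) y :=
    ((contDiffOn_pairing_inChart hθ hμ p).contDiffAt
      (extChartAt_target_mem_nhds_self p)).differentiableAt (by simp)
  have hμchart : HasFDerivAt (fun z => μ ((extChartAt (IP E) p).symm z))
      (formInChart (IP E) (dMap μ) p y) y :=
    ((hμ.mdifferentiableAt _).hasMFDerivAt.comp y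
      (mdifferentiableAt_extChartAt_symm' (mem_extChartAt_target p)).hasMFDerivAt).hasFDerivAt
  have hθchart : HasFDerivAt (formInChart (IP E) θ p) (fderiv ℝ (formInChart (IP E) θ p) y) y :=
    ((contDiffAt_formInChart hθ.smooth p).differentiableAt (by simp)).hasFDerivAt
  have hθapply (w : E × E) : HasFDerivAt (fun z => formInChart (IP E) θ p z w)
      ((fderiv ℝ (formInChart (IP E) θ p) y).flip w) y := by
    simpa using hθchart.clm_apply (hasFDerivAt_const w y)
  have hderiv (v w : E × E) : fderiv ℝ (fun z => (pairing μ θ).inChart p z ![w]) y v =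
      dMap μ p v (θ p w) + μ p (fderiv ℝ (formInChart (IP E) θ p) y v w) := by
    refine (DFunLike.congr_fun (hμchart.clm_apply (hθapply w)).fderiv v).trans ?_
    simp only [y, formInChart_self, extChartAt_to_inv, add_apply,
      ContinuousLinearMap.comp_apply, ContinuousLinearMap.flip_apply]
    exact add_comm (G := ℝ) _ _
  have hμsub : μ p (extDerivForm (IP E) θ p X Y) = _ - _ := map_sub (μ p) _ _
  refine (extDeriv_oneForm_apply hpairing X Y).trans
    ((congrArg₂ (· - ·) (hderiv X Y) (hderiv Y X)).trans ?_)
  rw [hμsub]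
  exact add_sub_add_comm (α := ℝ) _ _ _ _

end MomentMap

/-! ### Linear algebra of the form `Φ` -/

section BilinearForms

variable {E : Type*} [NormedAddCommGroup E] [NormedSpace ℝ E] {Φ : (E →L[ℝ] ℝ) ≃L[ℝ] E}

theorem symmForm_iff_symm_apply :
    SymmForm (Φ : (E →L[ℝ] ℝ) →L[ℝ] E) ↔ ∀ ρ σ, Φ.symm ρ σ = Φ.symm σ ρ := by
  constructor
  · intro h ρ σ
    simpa using h (Φ.symm ρ) (Φ.symm σ)
  · intro h x y
    simpa using (h (Φ y) (Φ x)).symm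

theorem SymmForm.posDefForm_add_comp_sq_iff (hΦ : SymmForm (Φ : (E →L[ℝ] ℝ) →L[ℝ] E))
    {B : E →L[ℝ] E →L[ℝ] ℝ} (hB : ∀ x y, B x y = -B y x) :
    PosDefForm ((Φ : (E →L[ℝ] ℝ) →L[ℝ] E) + (Φ : (E →L[ℝ] ℝ) →L[ℝ] E).comp
      ((B.comp (Φ : (E →L[ℝ] ℝ) →L[ℝ] E)) ^ 2)) ↔
    ∀ σ : E, σ ≠ 0 → 0 < Φ.symm σ σ - B σ (Φ (B σ)) := by
  rw [PosDefForm, Φ.toEquiv.forall_congr_left]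
  refine forall_congr' fun σ => imp_congr (by simp) (iff_of_eq (congrArg (0 < ·) ?_))
  have hswap : Φ.symm σ (Φ (B (Φ (B σ)))) = -B σ (Φ (B σ)) := by
    rw [← hB]
    simpa using hΦ (Φ.symm σ) (B (Φ (B σ)))
  rw [sub_eq_add_neg, ← hswap, ← map_add]
  change Φ.symm σ (Φ (Φ.symm σ) + Φ (B (Φ (B (Φ (Φ.symm σ)))))) = _
  rw [Φ.apply_symm_apply]

theorem SymmForm.complete_square (hΦ : SymmForm (Φ : (E →L[ℝ] ℝ) →L[ℝ] E))
    (B : E →L[ℝ] E →L[ℝ] ℝ) (ρ σ : E) :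
    Φ.symm σ σ + Φ.symm ρ ρ + 2 * B σ ρ =
      Φ.symm (ρ + Φ (B σ)) (ρ + Φ (B σ)) + (Φ.symm σ σ - B σ (Φ (B σ))) := by
  have hcross := symmForm_iff_symm_apply.1 hΦ ρ (Φ (B σ))
  simp only [map_add, add_apply, ContinuousLinearEquiv.symm_apply_apply] at hcross ⊢
  rw [hcross]
  ring

theorem SymmForm.posDefForm_and_posDefForm_iff (hΦ : SymmForm (Φ : (E →L[ℝ] ℝ) →L[ℝ] E))
    {B : E →L[ℝ] E →L[ℝ] ℝ} (hB : ∀ x y, B x y = -B y x) :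
    (PosDefForm (Φ : (E →L[ℝ] ℝ) →L[ℝ] E) ∧
      PosDefForm ((Φ : (E →L[ℝ] ℝ) →L[ℝ] E) + (Φ : (E →L[ℝ] ℝ) →L[ℝ] E).comp
        ((B.comp (Φ : (E →L[ℝ] ℝ) →L[ℝ] E)) ^ 2))) ↔
    ∀ z : E × E, z ≠ 0 → 0 < Φ.symm z.2 z.2 + Φ.symm z.1 z.1 + 2 * B z.2 z.1 := by
  have hposDef : PosDefForm (Φ : (E →L[ℝ] ℝ) →L[ℝ] E) ↔ ∀ τ : E, τ ≠ 0 → 0 < Φ.symm τ τ := by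
    rw [PosDefForm, Φ.toEquiv.forall_congr_left]
    exact forall_congr' fun τ => imp_congr (by simp) (by simp)
  simp only [hposDef, hΦ.posDefForm_add_comp_sq_iff hB, hΦ.complete_square B]
  constructor
  · rintro ⟨hpos, hrest⟩ ⟨ρ, σ⟩ hz
    rcases eq_or_ne σ 0 with rfl | hσ
    · simpa using hpos ρ fun hρ => hz (Prod.ext hρ rfl)
    · have hsquare : 0 ≤ Φ.symm (ρ + Φ (B σ)) (ρ + Φ (B σ)) := by
        rcases eq_or_ne (ρ + Φ (B σ)) 0 with h | h
        · simp [h]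
        · exact (hpos _ h).le
      exact add_pos_of_nonneg_of_pos hsquare (hrest σ hσ)
  · refine fun h => ⟨fun τ hτ => ?_, fun σ hσ => ?_⟩
    · simpa using h (τ, 0) (by simpa using hτ)
    · simpa using h (-Φ (B σ), σ) fun hz => hσ (congrArg Prod.snd hz)

end BilinearForms

/-! ### The metric determined by a moment map -/

section MomentMetric

variable {E : Type*} [NormedAddCommGroup E] [NormedSpace ℝ E]
  {G : Type*} [TopologicalSpace G] [ChartedSpace E G]

/-- The only bilinear form which can be a Hermitian metric on `(P, I)` with moment map `μ`. For
`X = ρ* + I σ*`, that is, `ρ = θ X` and `σ = L X`, the moment map condition forces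
`g(X, Y) = g(I σ*, Y) + g(I ρ*, I Y) = ⟨dμ(Y), σ⟩ + ⟨dμ(I Y), ρ⟩`. -/
def momentMetric (θ L : (p : G × E) → TP p →L[ℝ] E) (μ : G × E → (E →L[ℝ] ℝ)) (p : G × E) :
    TP p →L[ℝ] TP p →L[ℝ] ℝ :=
  let D : E × E →L[ℝ] E →L[ℝ] ℝ := dMap μ p
  let I : E × E →L[ℝ] E × E := cplx θ L p
  D.flip.comp (L p) + (D.comp I).flip.comp (θ p)

variable {θ L : (p : G × E) → TP p →L[ℝ] E} {μ : G × E → (E →L[ℝ] ℝ)}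

theorem momentMetric_apply (p : G × E) (X Y : TP p) : momentMetric θ L μ p X Y =
    dMap μ p Y (L p X) + dMap μ p (cplx θ L p Y) (θ p X) :=
  rfl

variable [FiniteDimensional ℝ E] [Group G] [LieGroup 𝓘(ℝ, E) ∞ G]

theorem momentMetric_cplx_fund (hθ : IsConnectionForm θ) (hL : IsNondegHorizontalForm L) (ρ : E)
    (p : G × E) (Y : TP p) :
    momentMetric θ L μ p (cplx θ L p (fund ρ p)) Y = dMap μ p Y ρ := by
  rw [momentMetric_apply, hL.apply_cplx hθ, hθ.apply_cplx hL, hθ.fund, hL.horizontal, neg_zero,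
    map_zero, add_zero]

theorem eq_momentMetric (hθ : IsConnectionForm θ) (hL : IsNondegHorizontalForm L) {p : G × E}
    {b : TP p →L[ℝ] TP p →L[ℝ] ℝ}
    (hherm : ∀ X Y, b (cplx θ L p X) (cplx θ L p Y) = b X Y)
    (hmoment : ∀ ρ Y, dMap μ p Y ρ = b (cplx θ L p (fund ρ p)) Y) (X Y : TP p) :
    b X Y = momentMetric θ L μ p X Y := by
  rw [momentMetric_apply, hmoment, hmoment, hherm, ← frame_inl hθ hL, cplx_frame hθ hL,
    ← frame_inl hθ hL, ← add_apply, ← map_add, ← map_add]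
  conv_lhs => rw [← frame_prod hθ hL p X]
  simp

theorem cplx_dAct (hθ : IsConnectionForm θ) (hL : IsNondegHorizontalForm L) (g : G) (p : G × E)
    (X : TP p) : cplx θ L (act g p) (dAct g p X) = dAct g p (cplx θ L p X) := by
  rw [← frame_prod hθ hL p X, dAct_frame hθ hL, cplx_frame hθ hL, cplx_frame hθ hL,
    dAct_frame hθ hL, map_neg]

theorem momentMetric_dAct (hθ : IsConnectionForm θ) (hL : IsNondegHorizontalForm L)
    (hμ : IsSmoothEquivariant μ) (g : G) (p : G × E) (X Y : TP p) :
    momentMetric θ L μ (act g p) (dAct g p X) (dAct g p Y) = momentMetric θ L μ p X Y := by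
  have hcoAd (ξ : E →L[ℝ] ℝ) (x : E) : coAd g ξ (Ad g x) = ξ x :=
    congrArg ξ (Ad_inv_apply_Ad_apply g x)
  rw [momentMetric_apply, cplx_dAct hθ hL, hθ.equivariant, hL.equivariant, dMap_dAct hμ,
    dMap_dAct hμ, hcoAd, hcoAd, momentMetric_apply]

theorem contMDiff_momentMetric (hθ : IsConnectionForm θ) (hL : IsNondegHorizontalForm L)
    (hμ : IsSmoothEquivariant μ) :
    ContMDiff (IP E) ((IP E).prod 𝓘(ℝ, E × E →L[ℝ] E × E →L[ℝ] ℝ)) ∞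
      (fun p : G × E => Bundle.TotalSpace.mk' (E × E →L[ℝ] E × E →L[ℝ] ℝ)
        (E := fun p : G × E => TP p →L[ℝ] TP p →L[ℝ] ℝ) p (momentMetric θ L μ p)) := by
  refine contMDiff_bilinear_of_inverse_apply (α := fun p => (θ p).prod (L p))
    (hθ.smooth.prodMk_space hL.smooth) (isInvertible_prod hθ hL) fun z w => ?_
  have hdMap (v : E × E) (x : E) :
      ContMDiff (IP E) 𝓘(ℝ, ℝ) ∞ fun p => dMap μ p (frame θ L p v) x :=
    ((contMDiff_mfderiv_apply hμ.smooth).comp (contMDiff_frame hθ hL v)).clm_apply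
      contMDiff_const
  refine ((hdMap w z.2).add (hdMap (-w.2, w.1) z.1)).congr fun p => ?_
  change momentMetric θ L μ p (frame θ L p z) (frame θ L p w) = _
  rw [momentMetric_apply, hL.apply_frame hθ, hθ.apply_frame hL, cplx_frame hθ hL]
  rfl

/-- The map `Φ⁻¹ : 𝔤 → 𝔤*` at `p`, characterized by `Dμ = Φ⁻¹ ∘ L`; as a bilinear form on `𝔤` it
is the restriction of the metric to the orbit through `p`. -/
def orbitForm (θ L : (p : G × E) → TP p →L[ℝ] E) (μ : G × E → (E →L[ℝ] ℝ)) (p : G × E) :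
    E →L[ℝ] (E →L[ℝ] ℝ) :=
  ((covDeriv θ μ p).comp (frame θ L p)).comp (ContinuousLinearMap.inr ℝ E E)

theorem covDeriv_eq_orbitForm (hθ : IsConnectionForm θ) (hL : IsNondegHorizontalForm L)
    (hμ : IsSmoothEquivariant μ) (p : G × E) (X : TP p) :
    covDeriv θ μ p X = orbitForm θ L μ p (L p X) := by
  have hsplit : fund (θ p X) p + frame θ L p (0, L p X) = X := by
    rw [← frame_inl hθ hL, ← map_add]
    simpa using frame_prod hθ hL p X
  conv_lhs => rw [← hsplit]
  rw [map_add, covDeriv_fund hθ hμ, zero_add]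
  rfl

theorem dMap_eq_orbitForm_sub_ad (hθ : IsConnectionForm θ) (hL : IsNondegHorizontalForm L)
    (hμ : IsSmoothEquivariant μ) (p : G × E) (X : TP p) :
    dMap μ p X = orbitForm θ L μ p (L p X) - ad G (μ p) (θ p X) := by
  rw [← covDeriv_eq_orbitForm hθ hL hμ, covDeriv_apply, add_sub_cancel_right]

theorem momentMetric_eq (hθ : IsConnectionForm θ) (hL : IsNondegHorizontalForm L)
    (hμ : IsSmoothEquivariant μ) (p : G × E) (X Y : TP p) :
    momentMetric θ L μ p X Y =
      orbitForm θ L μ p (L p Y) (L p X) + orbitForm θ L μ p (θ p Y) (θ p X) +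
        (ad G (μ p) (L p X) (θ p Y) - ad G (μ p) (θ p X) (L p Y)) := by
  simp only [momentMetric_apply, dMap_eq_orbitForm_sub_ad hθ hL hμ, hθ.apply_cplx hL,
    hL.apply_cplx hθ, sub_apply, map_neg, neg_apply]
  rw [ad_swap (G := G) (μ p) (θ p Y), ad_swap (G := G) (μ p) (L p Y)]
  ring

theorem momentMetric_cplx_cplx (hθ : IsConnectionForm θ) (hL : IsNondegHorizontalForm L)
    (hμ : IsSmoothEquivariant μ) (p : G × E) (X Y : TP p) :
    momentMetric θ L μ p (cplx θ L p X) (cplx θ L p Y) = momentMetric θ L μ p X Y := by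
  simp only [momentMetric_eq hθ hL hμ, hθ.apply_cplx hL, hL.apply_cplx hθ, map_neg, neg_apply]
  ring

theorem momentMetric_symm_iff (hθ : IsConnectionForm θ) (hL : IsNondegHorizontalForm L)
    (hμ : IsSmoothEquivariant μ) (p : G × E) :
    (∀ X Y, momentMetric θ L μ p X Y = momentMetric θ L μ p Y X) ↔
      ∀ ρ σ, orbitForm θ L μ p ρ σ = orbitForm θ L μ p σ ρ := by
  constructor
  · intro h ρ σ
    simpa [momentMetric_eq hθ hL hμ, hθ.apply_frame hL, hL.apply_frame hθ] using
      h (frame θ L p (σ, 0)) (frame θ L p (ρ, 0))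
  · intro h X Y
    rw [momentMetric_eq hθ hL hμ, momentMetric_eq hθ hL hμ, h (L p X), h (θ p X),
      ad_swap (G := G) (μ p) (L p X), ad_swap (G := G) (μ p) (θ p X)]
    ring

theorem momentMetric_pos_iff (hθ : IsConnectionForm θ) (hL : IsNondegHorizontalForm L)
    (hμ : IsSmoothEquivariant μ) (p : G × E) :
    (∀ X, X ≠ 0 → 0 < momentMetric θ L μ p X X) ↔ ∀ z : E × E, z ≠ 0 →
      0 < orbitForm θ L μ p z.2 z.2 + orbitForm θ L μ p z.1 z.1 + 2 * ad G (μ p) z.2 z.1 := by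
  have hself (X : TP p) : momentMetric θ L μ p X X = orbitForm θ L μ p (L p X) (L p X) +
      orbitForm θ L μ p (θ p X) (θ p X) + 2 * ad G (μ p) (L p X) (θ p X) := by
    rw [momentMetric_eq hθ hL hμ, ad_swap (G := G) (μ p) (θ p X)]
    ring
  constructor
  · intro h z hz
    have hframe : frame θ L p z ≠ 0 := fun h0 => hz <| by
      rw [← prod_frame hθ hL p z, h0, map_zero, map_zero, Prod.mk_zero_zero]
    simpa only [hself, hθ.apply_frame hL, hL.apply_frame hθ] using h _ hframe
  · intro h X hX
    rw [hself]
    refine h (θ p X, L p X) fun h0 => hX ?_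
    rw [← frame_prod hθ hL p X, h0, map_zero]

theorem d_pairing_eq_neg_momentMetric (hθ : IsConnectionForm θ) (hL : IsNondegHorizontalForm L)
    (hI : IsIntegrable (IP E) (cplx θ L)) (hμ : IsSmoothEquivariant μ) {p : G × E}
    (hsymm : ∀ ρ σ, orbitForm θ L μ p ρ σ = orbitForm θ L μ p σ ρ) (X Y : TP p) :
    (pairing μ θ).d p ![X, Y] = -momentMetric θ L μ p (cplx θ L p X) Y := by
  have hcurv : μ p (lieBr G (θ p X) (θ p Y) - lieBr G (L p X) (L p Y)) =
      ad G (μ p) (θ p X) (θ p Y) - ad G (μ p) (L p X) (L p Y) := map_sub (μ p) _ _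
  rw [d_pairing_apply hθ hμ, extDerivForm_connection hθ hL hI, hcurv]
  simp only [dMap_eq_orbitForm_sub_ad hθ hL hμ, momentMetric_eq hθ hL hμ, hθ.apply_cplx hL,
    hL.apply_cplx hθ, sub_apply, map_neg, neg_apply]
  rw [hsymm (θ p Y), ad_swap (G := G) (μ p) (θ p Y)]
  ring

end MomentMetric

section Kahler

variable {E : Type*} [NormedAddCommGroup E] [NormedSpace ℝ E] [FiniteDimensional ℝ E]
  {G : Type*} [TopologicalSpace G] [ChartedSpace E G] [Group G] [LieGroup 𝓘(ℝ, E) ∞ G]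
  {θ L : (p : G × E) → TP p →L[ℝ] E} {μ : G × E → (E →L[ℝ] ℝ)}

theorem orbitForm_eq_symm (hθ : IsConnectionForm θ) (hL : IsNondegHorizontalForm L) {p : G × E}
    {Φ : (E →L[ℝ] ℝ) ≃L[ℝ] E} (hΦ : ∀ X, L p X = Φ (covDeriv θ μ p X)) (σ : E) :
    orbitForm θ L μ p σ = Φ.symm σ := by
  have hσ := hΦ (frame θ L p (0, σ))
  rw [hL.apply_frame hθ] at hσ
  exact (Φ.symm_apply_eq.2 hσ).symm

theorem orbitForm_injective (hθ : IsConnectionForm θ) (hL : IsNondegHorizontalForm L)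
    (hreg : IsRegular θ μ) (p : G × E) : Function.Injective (orbitForm θ L μ p) := by
  rw [injective_iff_map_eq_zero]
  intro σ hσ
  obtain ⟨ρ, hρ⟩ := hreg p (frame θ L p (0, σ)) hσ
  have := hL.apply_frame hθ p (0, σ)
  rwa [hρ, hL.horizontal, eq_comm] at this

theorem existsUnique_apply_covDeriv (hθ : IsConnectionForm θ) (hL : IsNondegHorizontalForm L)
    (hμ : IsSmoothEquivariant μ) (hreg : IsRegular θ μ) :
    ∃! Φ : G × E → ((E →L[ℝ] ℝ) ≃L[ℝ] E), ∀ p X, L p X = Φ p (covDeriv θ μ p X) := by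
  have hdim : Module.finrank ℝ E = Module.finrank ℝ (E →L[ℝ] ℝ) :=
    Subspace.dual_finrank_eq.symm.trans LinearMap.toContinuousLinearMap.finrank_eq
  let Ψ (p : G × E) : E ≃L[ℝ] (E →L[ℝ] ℝ) :=
    (LinearEquiv.ofInjectiveOfFinrankEq (orbitForm θ L μ p).toLinearMap
      (orbitForm_injective hθ hL hreg p) hdim).toContinuousLinearEquiv
  refine ⟨fun p => (Ψ p).symm, fun p X => ?_, fun Φ hΦ => funext fun p => ?_⟩
  · rw [covDeriv_eq_orbitForm hθ hL hμ]
    exact ((Ψ p).symm_apply_apply _).symm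
  · have hΨ : Ψ p = (Φ p).symm := ContinuousLinearEquiv.ext <| funext fun σ =>
      orbitForm_eq_symm hθ hL (hΦ p) σ
    rw [hΨ, ContinuousLinearEquiv.symm_symm]

/-- `momentMetric` as a Riemannian metric. -/
def kahlerMetric (hθ : IsConnectionForm θ) (hL : IsNondegHorizontalForm L)
    (hμ : IsSmoothEquivariant μ)
    (hsymm : ∀ p X Y, momentMetric θ L μ p X Y = momentMetric θ L μ p Y X)
    (hpos : ∀ p X, X ≠ 0 → 0 < momentMetric θ L μ p X X) : Metric E G where
  inner := momentMetric θ L μ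
  symm := hsymm
  pos := hpos
  isVonNBounded p :=
    isVonNBounded_of_isCoercive (V := E × E) (b := momentMetric θ L μ p)
      (isCoercive_of_posDef (hpos p))
  contMDiff := contMDiff_momentMetric hθ hL hμ

theorem isInvariantKahler_kahlerMetric (hθ : IsConnectionForm θ) (hL : IsNondegHorizontalForm L)
    (hI : IsIntegrable (IP E) (cplx θ L)) (hμ : IsSmoothEquivariant μ)
    (hsymm : ∀ p X Y, momentMetric θ L μ p X Y = momentMetric θ L μ p Y X)
    (hpos : ∀ p X, X ≠ 0 → 0 < momentMetric θ L μ p X X) :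
    IsInvariantKahler (cplx θ L) (kahlerMetric hθ hL hμ hsymm hpos) (-(pairing μ θ).d) where
  invariant := momentMetric_dAct hθ hL hμ
  hermitian := momentMetric_cplx_cplx hθ hL hμ
  kahlerForm p X Y := neg_eq_iff_eq_neg.2 (d_pairing_eq_neg_momentMetric hθ hL hI hμ
    ((momentMetric_symm_iff hθ hL hμ p).1 (hsymm p)) X Y)
  closed := by
    rw [d_neg, d_d_eq_zero (contDiffOn_pairing_inChart hθ hμ), neg_zero]

theorem isMomentMap_neg_d_pairing (hθ : IsConnectionForm θ) (hL : IsNondegHorizontalForm L)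
    (hI : IsIntegrable (IP E) (cplx θ L)) (hμ : IsSmoothEquivariant μ)
    (hsymm : ∀ p ρ σ, orbitForm θ L μ p ρ σ = orbitForm θ L μ p σ ρ) :
    IsMomentMap μ (-(pairing μ θ).d) := fun ρ p X =>
  (momentMetric_cplx_fund hθ hL ρ p X).symm.trans (neg_eq_iff_eq_neg.2
    (d_pairing_eq_neg_momentMetric hθ hL hI hμ (hsymm p) (fund ρ p) X)).symm

section Uniqueness

variable {g : Metric E G} {κ : DiffForm (IP E) (M := G × E) 2}

theorem inner_eq_momentMetric (hθ : IsConnectionForm θ) (hL : IsNondegHorizontalForm L)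
    (hg : IsInvariantKahler (cplx θ L) g κ) (hκ : IsMomentMap μ κ) (p : G × E) (X Y : TP p) :
    g.inner p X Y = momentMetric θ L μ p X Y :=
  eq_momentMetric hθ hL (hg.hermitian p)
    (fun ρ Z => (hκ ρ p Z).trans (hg.kahlerForm p (fund ρ p) Z)) X Y

theorem momentMetric_symm (hθ : IsConnectionForm θ) (hL : IsNondegHorizontalForm L)
    (hg : IsInvariantKahler (cplx θ L) g κ) (hκ : IsMomentMap μ κ) (p : G × E) (X Y : TP p) :
    momentMetric θ L μ p X Y = momentMetric θ L μ p Y X := by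
  rw [← inner_eq_momentMetric hθ hL hg hκ, ← inner_eq_momentMetric hθ hL hg hκ, g.symm]

theorem orbitForm_symm (hθ : IsConnectionForm θ) (hL : IsNondegHorizontalForm L)
    (hμ : IsSmoothEquivariant μ) (hg : IsInvariantKahler (cplx θ L) g κ) (hκ : IsMomentMap μ κ)
    (p : G × E) (ρ σ : E) : orbitForm θ L μ p ρ σ = orbitForm θ L μ p σ ρ :=
  (momentMetric_symm_iff hθ hL hμ p).1 (momentMetric_symm hθ hL hg hκ p) ρ σ

theorem kahlerForm_eq_neg_d_pairing (hθ : IsConnectionForm θ) (hL : IsNondegHorizontalForm L)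
    (hI : IsIntegrable (IP E) (cplx θ L)) (hμ : IsSmoothEquivariant μ)
    (hg : IsInvariantKahler (cplx θ L) g κ) (hκ : IsMomentMap μ κ) :
    κ = -(pairing μ θ).d := by
  have hXY (p : G × E) (X Y : TP p) : κ p ![X, Y] = -(pairing μ θ).d p ![X, Y] := by
    rw [hg.kahlerForm, inner_eq_momentMetric hθ hL hg hκ,
      d_pairing_eq_neg_momentMetric hθ hL hI hμ (orbitForm_symm hθ hL hμ hg hκ p), neg_neg]
  refine funext fun p => ContinuousAlternatingMap.ext fun v => ?_
  have hv : v = ![v 0, v 1] := funext fun i => by fin_cases i <;> rfl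
  rw [hv]
  exact hXY p (v 0) (v 1)

end Uniqueness

theorem exists_isInvariantKahler_isMomentMap_iff (hθ : IsConnectionForm θ)
    (hL : IsNondegHorizontalForm L) (hI : IsIntegrable (IP E) (cplx θ L))
    (hμ : IsSmoothEquivariant μ) :
    (∃ (g : Metric E G) (κ : DiffForm (IP E) (M := G × E) 2),
        IsInvariantKahler (cplx θ L) g κ ∧ IsMomentMap μ κ) ↔
      ∀ p, (∀ ρ σ, orbitForm θ L μ p ρ σ = orbitForm θ L μ p σ ρ) ∧
        ∀ X, X ≠ 0 → 0 < momentMetric θ L μ p X X := by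
  constructor
  · rintro ⟨g, κ, hg, hκ⟩ p
    refine ⟨orbitForm_symm hθ hL hμ hg hκ p, fun X hX => ?_⟩
    rw [← inner_eq_momentMetric hθ hL hg hκ]
    exact g.pos p X hX
  · intro h
    have hsymm p := (momentMetric_symm_iff hθ hL hμ p).2 (h p).1
    exact ⟨kahlerMetric hθ hL hμ hsymm fun p => (h p).2, _,
      isInvariantKahler_kahlerMetric hθ hL hI hμ hsymm fun p => (h p).2,
      isMomentMap_neg_d_pairing hθ hL hI hμ fun p => (h p).1⟩

end Kahler

end KahlerGC

end

open KahlerGC in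
theorem mainTheorem4 {E : Type*} [NormedAddCommGroup E] [NormedSpace ℝ E] [FiniteDimensional ℝ E]
    {G : Type*} [TopologicalSpace G] [ChartedSpace E G] [Group G] [LieGroup 𝓘(ℝ, E) ∞ G]
    (θ L : (p : G × E) → TP p →L[ℝ] E)
    (hθ : IsConnectionForm θ) (hL : IsNondegHorizontalForm L)
    (hI : IsIntegrable (IP E) (cplx θ L))
    (μ : G × E → (E →L[ℝ] ℝ)) (hμ : IsSmoothEquivariant μ)
    (hreg : IsRegular θ μ) :
    (∃! Φ : G × E → ((E →L[ℝ] ℝ) ≃L[ℝ] E), ∀ p X, L p X = Φ p (covDeriv θ μ p X)) ∧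
    ∀ Φ : G × E → ((E →L[ℝ] ℝ) ≃L[ℝ] E), (∀ p X, L p X = Φ p (covDeriv θ μ p X)) →
      ((∃ (g : Metric E G) (κ : DiffForm (IP E) (M := G × E) 2),
          IsInvariantKahler (cplx θ L) g κ ∧ IsMomentMap μ κ) ↔
        ∀ p, SymmForm (Φ p : (E →L[ℝ] ℝ) →L[ℝ] E) ∧
          PosDefForm (Φ p : (E →L[ℝ] ℝ) →L[ℝ] E) ∧
          PosDefForm ((Φ p : (E →L[ℝ] ℝ) →L[ℝ] E) +
            (Φ p : (E →L[ℝ] ℝ) →L[ℝ] E).comp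
              (((ad G (μ p)).comp (Φ p : (E →L[ℝ] ℝ) →L[ℝ] E)) ^ 2))) ∧
      ∀ (g : Metric E G) (κ : DiffForm (IP E) (M := G × E) 2),
        IsInvariantKahler (cplx θ L) g κ → IsMomentMap μ κ →
          (∀ p (X Y : TP p), g.inner p X Y =
            (covDeriv θ μ p Y) (Φ p (covDeriv θ μ p X)) + ((Φ p).symm (θ p X)) (θ p Y)
              + μ p (lieBr G (Φ p (covDeriv θ μ p X)) (θ p Y)
                  - lieBr G (θ p X) (Φ p (covDeriv θ μ p Y)))) ∧
          κ = -(pairing μ θ).d := by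
  refine ⟨existsUnique_apply_covDeriv hθ hL hμ hreg, fun Φ hΦ => ⟨?_, fun g κ hg hκ =>
    ⟨fun p X Y => ?_, kahlerForm_eq_neg_d_pairing hθ hL hI hμ hg hκ⟩⟩⟩
  · rw [exists_isInvariantKahler_isMomentMap_iff hθ hL hI hμ]
    refine forall_congr' fun p => ?_
    simp only [symmForm_iff_symm_apply, momentMetric_pos_iff hθ hL hμ,
      orbitForm_eq_symm hθ hL (hΦ p)]
    exact and_congr_right fun hsymm => (SymmForm.posDefForm_and_posDefForm_iff
      (symmForm_iff_symm_apply.2 hsymm) (ad_swap (μ p))).symm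
  · have hsymm := orbitForm_symm hθ hL hμ hg hκ p (θ p Y) (θ p X)
    have had : ad G (μ p) (L p X) (θ p Y) - ad G (μ p) (θ p X) (L p Y) =
        μ p (lieBr G (L p X) (θ p Y) - lieBr G (θ p X) (L p Y)) := (map_sub (μ p) _ _).symm
    rw [← hΦ, ← hΦ, covDeriv_eq_orbitForm hθ hL hμ, ← orbitForm_eq_symm hθ hL (hΦ p), ← hsymm,
      ← had, inner_eq_momentMetric hθ hL hg hκ, momentMetric_eq hθ hL hμ]
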